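/- Let $K$ be a field of characteristic zero (for instance a subfield of $\mathbb C$), $\overline K$ an algebraic closure of $K$, and $L$ a field with $K\subseteq L\subseteq\overline K$. Let $b\ge 2$ and $r\ge0$ be integers and let $\ell_0,\dots,\ell_r\in K[x]$ with $\ell_0\ne0$ and $\ell_r\neq 0$. Consider the linear Mahler equation $$\ell_r M^r y+\dots+\ell_1 My+\ell_0 y=0,\qquad\text{(L)}$$ where $M$ is the Mahler operator $y(x)\mapsto y(x^b)$. *Generalized series.* For a field $F$, let $\mathrm{Pui}(F)=\bigcup_{q\ge1}F((x^{1/q}))$ be the field of Puiseux series and $\mathrm{Ram}(F)=\bigcup_{q\ge1}F(x^{1/q})\subseteq\mathrm{Pui}(F)$ the field of ramified rational functions. Let $D_F=\bigoplus_{\lambda\in F\setminus\{0\}}e(\lambda)\,\mathrm{Pui}(F)$ be the ring with $e(\lambda)e(\mu)=e(\lambda\mu)$ and $e(1)=1$. The operator $M$ acts on $D_F$ as the ring endomorphism with $Me(\lambda)=\lambda e(\lambda)$ and $(Mp)(x)=p(x^b)$ for $p\in\mathrm{Pui}(F)$. An element $y\in D_L$ is *hypergeometric* if $My=uy$ for some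 $u\in\mathrm{Ram}(L)$. Elements $y_1,y_2\in D_L$ are *similar* if $y_1=uy_2$ for some nonzero $u\in\mathrm{Ram}(L)$. This is an equivalence relation; the nontrivial similarity classes of hypergeometric solutions of (L) in $D_L$ are its classes other than $\{0\}$ on the set of those solutions. *Newton polygon.* The lower Newton polygon of (L) is the lower convex hull of the points $(b^k,m)$ for which the coefficient $\ell_{k,m}$ of $x^m$ in $\ell_k$ is nonzero. The characteristic polynomial of an edge whose left end has abscissa $b^{k_1}$ is $\chi(X)=\sum\ell_{k,m}X^{k-k_1}$, summed over the points $(b^k,m)$ above that lie on the edge. For $\lambda\in\overline K$, an edge is *$\lambda$-admissible* if its characteristic polynomial vanishes at $\lambda$. Let $q_\lambda$ be the least common multiple of those denominators, in lowest terms, of the slopes of the $\lambda$-admissible edges that are coprime to $b$ (with $q_\lambda=1$ if there are none). Let $\Lambda'$ be the set of all $\lambda\in\overline K$ for which there is a $\lambda$-admissible edge and (L) has a nonzero solution in $e(\lambda)\,\mathrm{Pui}(\overline K)$. **Proposition.** Let $\mathcal C\subseteq D_L$ be a nontrivial similarity class of hypergeometric solutions of (L), and let $\mathfrak H=\mathcal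 C\cup\{0\}$. Then there is exactly one tuple $(\lambda,g,(p_j)_{1\le j\le s})$ consisting of an element $\lambda\in L\cap\Lambda'$, a rational function $g\in L(x)$ with $g(0)=1$, an integer $s>0$ and Laurent polynomials $p_1,\dots,p_s\in L[x,x^{-1}]$, such that: 1. the $s$ generalized series $$e(\lambda)\;p_j(x^{1/q_\lambda})\;\prod_{k\ge0}\frac1{g(x^{b^k/q_\lambda})},\qquad 1\le j\le s,$$ form a basis of $\mathfrak H$, which is an $L$-linear subspace of $D_L$; 2. the family $(p_1,\dots,p_s)$ is in reduced echelon form with respect to ascending degree: the valuations $v_j$ of the $p_j$ satisfy $v_1<\dots<v_s$, the coefficient of $x^{v_j}$ in $p_j$ is $1$, and the coefficient of $x^{v_j}$ in $p_i$ is $0$ for $i\ne j$; 3. $p_1,\dots,p_s$ are coprime in $L[x,x^{-1}]$, that is, their only common divisors are units. -/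

import Mathlib

open Polynomial

noncomputable section

namespace Mahler

/-! ### Puiseux series and ramified rational functions -/

section Puiseux

variable (L : Type*) [Field L]

/-- The substitution `x ↦ x ^ (1 / q)`, from Laurent series in `x` to Hahn series with rational
exponents. -/
def hahnRamify (q : ℕ+) : LaurentSeries L →+* HahnSeries ℚ L :=
  HahnSeries.embDomainRingHom
    { toFun := fun n : ℤ => (n : ℚ) / (q : ℕ)
      map_zero' := by simp
      map_add' := fun m n => by push_cast; ring }
    (fun m n h => by
      have hq : ((q : ℕ) : ℚ) ≠ 0 := by exact_mod_cast q.ne_zero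
      have h' : (m : ℚ) / (q : ℕ) = (n : ℚ) / (q : ℕ) := h
      field_simp at h'
      exact_mod_cast h')
    (fun m n => by
      have hq : (0 : ℚ) < (q : ℕ) := by exact_mod_cast q.pos
      change (m : ℚ) / (q : ℕ) ≤ (n : ℚ) / (q : ℕ) ↔ m ≤ n
      rw [div_le_div_iff_of_pos_right hq]
      exact Int.cast_le)

/-- The substitution `x ↦ x ^ n` on Laurent series. -/
def laurentExpand (n : ℕ+) : LaurentSeries L →+* LaurentSeries L :=
  HahnSeries.embDomainRingHom
    { toFun := fun k : ℤ => ((n : ℕ) : ℤ) * k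
      map_zero' := by simp
      map_add' := fun m n => by ring }
    (fun k l h => by
      have hn : ((n : ℕ) : ℤ) ≠ 0 := by exact_mod_cast n.ne_zero
      exact mul_left_cancel₀ hn h)
    (fun k l => by
      have hn : (0 : ℤ) < (n : ℕ) := by exact_mod_cast n.pos
      exact mul_le_mul_iff_right₀ hn)

/-- The substitution `x ↦ x ^ b` on Hahn series with rational exponents. -/
def hahnExpand (b : ℕ+) : HahnSeries ℚ L →+* HahnSeries ℚ L :=
  HahnSeries.embDomainRingHom
    { toFun := fun k : ℚ => ((b : ℕ) : ℚ) * k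
      map_zero' := by simp
      map_add' := fun m n => by ring }
    (fun k l h => by
      have hn : ((b : ℕ) : ℚ) ≠ 0 := by exact_mod_cast b.ne_zero
      exact mul_left_cancel₀ hn h)
    (fun k l => by
      have hn : (0 : ℚ) < (b : ℕ) := by exact_mod_cast b.pos
      exact mul_le_mul_iff_right₀ hn)

variable {L}

theorem embDomain_comp_aux {Γ₁ Γ₂ Γ₃ : Type*} [PartialOrder Γ₁] [PartialOrder Γ₂]
    [PartialOrder Γ₃] (f : Γ₁ ↪o Γ₂) (g : Γ₂ ↪o Γ₃) (h : Γ₁ ↪o Γ₃) (hfg : ∀ a, g (f a) = h a)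
    (x : HahnSeries Γ₁ L) :
    HahnSeries.embDomain g (HahnSeries.embDomain f x) = HahnSeries.embDomain h x := by
  ext c
  by_cases hc : c ∈ Set.range h
  · obtain ⟨a, rfl⟩ := hc
    rw [HahnSeries.embDomain_coeff, ← hfg, HahnSeries.embDomain_coeff, HahnSeries.embDomain_coeff]
  · rw [HahnSeries.embDomain_of_notMem_range hc]
    by_cases hc' : c ∈ Set.range g
    · obtain ⟨d, rfl⟩ := hc'
      rw [HahnSeries.embDomain_coeff]
      apply HahnSeries.embDomain_of_notMem_range
      rintro ⟨a, rfl⟩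
      exact hc ⟨a, (hfg a).symm⟩
    · exact HahnSeries.embDomain_of_notMem_range hc'

theorem hahnRamify_mul_expand (q n : ℕ+) (f : LaurentSeries L) :
    hahnRamify L (q * n) (laurentExpand L n f) = hahnRamify L q f := by
  refine embDomain_comp_aux (L := L) (Γ₁ := ℤ) (Γ₂ := ℤ) (Γ₃ := ℚ) ⟨⟨_, _⟩, _⟩ ⟨⟨_, _⟩, _⟩ ⟨⟨_, _⟩, _⟩
    (fun a => ?_) f
  change (((((n : ℕ) : ℤ) * a : ℤ)) : ℚ) / ((q * n : ℕ+) : ℕ) = (a : ℚ) / (q : ℕ)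
  have hn : ((n : ℕ) : ℚ) ≠ 0 := by exact_mod_cast n.ne_zero
  have hq : ((q : ℕ) : ℚ) ≠ 0 := by exact_mod_cast q.ne_zero
  push_cast
  field_simp

theorem hahnExpand_hahnRamify (b q : ℕ+) (f : LaurentSeries L) :
    hahnExpand L b (hahnRamify L q f) = hahnRamify L q (laurentExpand L b f) := by
  have h1 : ((b : ℕ) : ℚ) ≠ 0 := by exact_mod_cast b.ne_zero
  have h2 : hahnRamify L q f = hahnRamify L (q * b) (laurentExpand L b f) :=
    (hahnRamify_mul_expand q b f).symm
  rw [h2]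
  refine embDomain_comp_aux (L := L) (Γ₁ := ℤ) (Γ₂ := ℚ) (Γ₃ := ℚ) ⟨⟨_, _⟩, _⟩ ⟨⟨_, _⟩, _⟩ ⟨⟨_, _⟩, _⟩
    (fun a => ?_) _
  change ((b : ℕ) : ℚ) * ((a : ℚ) / ((q * b : ℕ+) : ℕ)) = (a : ℚ) / (q : ℕ)
  have hq : ((q : ℕ) : ℚ) ≠ 0 := by exact_mod_cast q.ne_zero
  push_cast
  field_simp

theorem exists_common_ramification {f g : HahnSeries ℚ L}
    (hf : ∃ q : ℕ+, f ∈ Set.range (hahnRamify L q))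
    (hg : ∃ q : ℕ+, g ∈ Set.range (hahnRamify L q)) :
    ∃ (q : ℕ+) (f' g' : LaurentSeries L), hahnRamify L q f' = f ∧ hahnRamify L q g' = g := by
  obtain ⟨q, f', rfl⟩ := hf
  obtain ⟨n, g', rfl⟩ := hg
  refine ⟨q * n, laurentExpand L n f', laurentExpand L q g', hahnRamify_mul_expand q n f', ?_⟩
  rw [mul_comm]
  exact hahnRamify_mul_expand n q g'

variable (L)

/-- The field of Puiseux series over `L`: the union over `q ≥ 1` of the fields `L((x^{1/q}))`. -/
def Puiseux : Subfield (HahnSeries ℚ L) where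
  carrier := {f | ∃ q : ℕ+, f ∈ Set.range (hahnRamify L q)}
  mul_mem' := by
    intro f g hf hg
    obtain ⟨q, f', g', rfl, rfl⟩ := exists_common_ramification hf hg
    exact ⟨q, f' * g', map_mul _ _ _⟩
  add_mem' := by
    intro f g hf hg
    obtain ⟨q, f', g', rfl, rfl⟩ := exists_common_ramification hf hg
    exact ⟨q, f' + g', map_add _ _ _⟩
  zero_mem' := ⟨1, 0, map_zero _⟩
  one_mem' := ⟨1, 1, map_one _⟩
  neg_mem' := by
    rintro _ ⟨q, f, rfl⟩
    exact ⟨q, -f, map_neg _ _⟩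
  inv_mem' := by
    rintro _ ⟨q, f, rfl⟩
    exact ⟨q, f⁻¹, map_inv₀ _ _⟩

variable {L}

/-- `f(x) ↦ f(x^{1/q})`, from Laurent series to Puiseux series. -/
def ramify (q : ℕ+) : LaurentSeries L →+* Puiseux L :=
  (hahnRamify L q).codRestrict (Puiseux L) (fun f => ⟨q, f, rfl⟩)

/-- Elements of `L` are constant Puiseux series. -/
instance : Algebra L (Puiseux L) := ((ramify 1).comp HahnSeries.C).toAlgebra

/-- The Mahler operator `f(x) ↦ f(x^b)` on Puiseux series. -/
def mahlerPuiseux (b : ℕ+) : Puiseux L →+* Puiseux L :=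
  ((hahnExpand L b).comp (Puiseux L).subtype).codRestrict (Puiseux L) (by
    rintro ⟨_, q, f, rfl⟩
    exact ⟨q, laurentExpand L b f, (hahnExpand_hahnRamify b q f).symm⟩)

/-- A Laurent polynomial, viewed as a Laurent series. -/
def laurentPolyToSeries (p : LaurentPolynomial L) : LaurentSeries L :=
  ∑ n ∈ p.coeff.support, HahnSeries.single n (p.coeff n)

/-- For a polynomial `A`, the Puiseux series `A(x^{1/q})`. -/
def polyRamify (q : ℕ+) (A : L[X]) : Puiseux L :=
  ramify q (HahnSeries.ofPowerSeries ℤ L (A : PowerSeries L))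

variable (L)

/-- The ramified rational functions: the union over `q ≥ 1` of the fields `L(x^{1/q})`, as a
subset of the field of Puiseux series. -/
def RamRat : Set (Puiseux L) :=
  {u | ∃ (q : ℕ+) (A B : L[X]), B ≠ 0 ∧ u = polyRamify q A / polyRamify q B}

end Puiseux

/-! ### The difference ring of generalized series -/

section DifferenceRing

/-- The ring `⨁_{λ ∈ L \ {0}} e(λ) · Puiseux(L)`, with `e(λ) e(μ) = e(λ μ)` and `e(1) = 1`; the
element `e(λ) p` is `MonoidAlgebra.single λ p`. -/
abbrev GenSeries (L : Type*) [Field L] : Type _ := MonoidAlgebra (Puiseux L) Lˣ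

variable {L : Type*} [Field L]

/-- The generalized series `e(λ) · p`. -/
def expo (lam : Lˣ) (p : Puiseux L) : GenSeries L := MonoidAlgebra.single lam p

/-- The Mahler operator on generalized series: the ring endomorphism which is `p(x) ↦ p(x^b)` on
Puiseux series and maps `e(λ)` to `λ e(λ)`. -/
def mahler (b : ℕ+) : GenSeries L →+* GenSeries L :=
  MonoidAlgebra.liftNCRingHom
    ((MonoidAlgebra.singleOneRingHom : Puiseux L →+* GenSeries L).comp
      (mahlerPuiseux b))
    { toFun := fun lam : Lˣ => expo lam (algebraMap L (Puiseux L) (lam : L))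
      map_one' := by simp [expo, MonoidAlgebra.one_def]
      map_mul' := fun lam mu => by simp [expo, MonoidAlgebra.single_mul_single] }
    (fun _ _ => Commute.all _ _)

theorem mahler_expo (b : ℕ+) (lam : Lˣ) (p : Puiseux L) :
    mahler b (expo lam p) = expo lam ((lam : L) • mahlerPuiseux b p) := by
  simp [mahler, expo, MonoidAlgebra.single_mul_single, Algebra.smul_def, mul_comm]

/-- `y` is hypergeometric over the field of ramified rational functions: `M y = u y` for some
ramified rational function `u`. -/
def IsRamRatHypergeometric (b : ℕ+) (y : GenSeries L) : Prop :=
  ∃ u ∈ RamRat L, mahler b y = u • y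

/-- `y₁` and `y₂` are similar over the field of ramified rational functions. -/
def RamRatSimilar (y₁ y₂ : GenSeries L) : Prop :=
  ∃ u ∈ RamRat L, u ≠ 0 ∧ y₁ = u • y₂

variable {K : Type*} [Field K] [Algebra K L]

/-- The value `ℓ_r M^r y + ⋯ + ℓ_1 M y + ℓ_0 y` of a linear Mahler operator at `y`. -/
def applyOp (b : ℕ+) {r : ℕ} (ℓ : Fin (r + 1) → K[X]) (y : GenSeries L) : GenSeries L :=
  ∑ k : Fin (r + 1), polyRamify 1 ((ℓ k).map (algebraMap K L)) • (mahler b)^[(k : ℕ)] y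

/-- `C` is a nontrivial class, for similarity over the ramified rational functions, of the
hypergeometric solutions of the equation: the class of some nonzero hypergeometric solution `y₀`. -/
def IsNontrivialSimilarityClass (b : ℕ+) {r : ℕ} (ℓ : Fin (r + 1) → K[X])
    (C : Set (GenSeries L)) : Prop :=
  ∃ y₀ : GenSeries L, y₀ ≠ 0 ∧ applyOp b ℓ y₀ = 0 ∧ IsRamRatHypergeometric b y₀ ∧
    C = {y | applyOp b ℓ y = 0 ∧ IsRamRatHypergeometric b y ∧ RamRatSimilar y y₀}

end DifferenceRing

/-! ### The lower Newton polygon, its characteristic polynomials, the ramification bounds -/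

section Newton

variable {K : Type*} [Field K] (b : ℕ+) {r : ℕ} (ℓ : Fin (r + 1) → K[X])

/-- The slope of the line through the lowest points at abscissae `b^i` and `b^j`. The lowest point
at abscissa `b^k` exists if `ℓ_k ≠ 0`, and its ordinate is the valuation of `ℓ_k`. -/
def edgeSlope (i j : Fin (r + 1)) : ℚ :=
  (((ℓ j).natTrailingDegree : ℚ) - ((ℓ i).natTrailingDegree : ℚ)) /
    (((b : ℕ) : ℚ) ^ (j : ℕ) - ((b : ℕ) : ℚ) ^ (i : ℕ))

/-- The ordinate at abscissa `b^k` of the line through the lowest points at `b^i` and `b^j`. -/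
def edgeHeight (i j k : Fin (r + 1)) : ℚ :=
  ((ℓ i).natTrailingDegree : ℚ) +
    edgeSlope b ℓ i j * (((b : ℕ) : ℚ) ^ (k : ℕ) - ((b : ℕ) : ℚ) ^ (i : ℕ))

/-- The lowest points at abscissae `b^i < b^j` are the end points of an edge of the lower Newton
polygon: all points lie on or above the line through them, and no point of that line lies outside
of the segment. -/
def IsLowerEdge (i j : Fin (r + 1)) : Prop :=
  i < j ∧ ℓ i ≠ 0 ∧ ℓ j ≠ 0 ∧ ∀ k : Fin (r + 1), ℓ k ≠ 0 →
    edgeHeight b ℓ i j k ≤ ((ℓ k).natTrailingDegree : ℚ) ∧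
    (((ℓ k).natTrailingDegree : ℚ) = edgeHeight b ℓ i j k → i ≤ k ∧ k ≤ j)

open scoped Classical in
/-- The characteristic polynomial of the edge between abscissae `b^i` and `b^j`: the sum of
`c X^(k - i)` over the terms `c x^m M^k` of the operator whose point `(b^k, m)` is on the edge. -/
def edgeCharPoly (i j : Fin (r + 1)) : K[X] :=
  ∑ k ∈ Finset.Icc i j,
    if ((ℓ k).natTrailingDegree : ℚ) = edgeHeight b ℓ i j k then
      Polynomial.monomial ((k : ℕ) - (i : ℕ)) (ℓ k).trailingCoeff
    else 0

variable {Kbar : Type*} [Field Kbar] [Algebra K Kbar]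

/-- The edge between `b^i` and `b^j` is `λ`-admissible. -/
def IsAdmissibleEdge (lam : Kbar) (i j : Fin (r + 1)) : Prop :=
  IsLowerEdge b ℓ i j ∧ aeval lam (edgeCharPoly b ℓ i j) = 0

variable (Kbar) in
/-- The set `Λ` of all roots of all characteristic polynomials. -/
def rootSet : Set Kbar := {lam | ∃ i j : Fin (r + 1), IsAdmissibleEdge b ℓ lam i j}

variable (Kbar) in
/-- The set `Λ'` of all `λ` in `Λ` such that the equation has a nonzero solution of the form
`e(λ) p` with a Puiseux series `p` over `Kbar`. -/
def solRootSet : Set Kbar :=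
  {lam | lam ∈ rootSet b ℓ Kbar ∧
    ∃ (mu : Kbarˣ) (p : Puiseux Kbar), (mu : Kbar) = lam ∧ p ≠ 0 ∧ applyOp b ℓ (expo mu p) = 0}

open scoped Classical in
/-- The ramification bound `q_λ`: the least common multiple of those denominators of slopes of
`λ`-admissible edges that are coprime to `b`. -/
def ramBound (lam : Kbar) : ℕ+ :=
  ⟨(Finset.univ.filter fun e : Fin (r + 1) × Fin (r + 1) =>
      IsAdmissibleEdge b ℓ lam e.1 e.2 ∧ Nat.Coprime b (edgeSlope b ℓ e.1 e.2).den).lcm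
        fun e => (edgeSlope b ℓ e.1 e.2).den,
    Nat.pos_of_ne_zero fun h => by
      obtain ⟨e, -, he⟩ := Finset.lcm_eq_zero_iff.mp h
      exact (edgeSlope b ℓ e.1 e.2).den_nz he⟩

end Newton

/-! ### Normal forms -/

section NormalForm

variable {L : Type*} [Field L]

/-- The power series `1 / g(x^(b^k))`, for a rational function `g` with `g(0) = 1`. -/
def invFactor (b : ℕ+) (g : RatFunc L) (k : ℕ) : PowerSeries L :=
  ((expand L ((b : ℕ) ^ k) g.denom : L[X]) : PowerSeries L) *
    ((expand L ((b : ℕ) ^ k) g.num : L[X]) : PowerSeries L)⁻¹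

/-- The infinite product `∏_{k ≥ 0} 1 / g(x^(b^k))`, for a rational function `g` with `g(0) = 1`
and for `b ≥ 2`. Its `n`th coefficient is that of every product of at least `n + 1` factors, see
`coeff_prod_invFactor`. -/
def infProd (b : ℕ+) (g : RatFunc L) : PowerSeries L :=
  PowerSeries.mk fun n =>
    PowerSeries.coeff n (∏ k ∈ Finset.range (n + 1), invFactor b g k)

theorem coeff_prod_of_eq_one_mod {A : ℕ → PowerSeries L} {n : ℕ}
    (hA : ∀ k, n < k → ∀ i ≤ n, PowerSeries.coeff i (A k) = PowerSeries.coeff i 1) (m : ℕ)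
    (hm : n + 1 ≤ m) :
    PowerSeries.coeff n (∏ k ∈ Finset.range m, A k) =
      PowerSeries.coeff n (∏ k ∈ Finset.range (n + 1), A k) := by
  induction m, hm using Nat.le_induction with
  | base => rfl
  | succ m hm ih =>
    rw [Finset.prod_range_succ, ← ih]
    conv_rhs => rw [← mul_one (∏ k ∈ Finset.range m, A k)]
    rw [PowerSeries.coeff_mul, PowerSeries.coeff_mul]
    refine Finset.sum_congr rfl fun x hx => ?_
    rw [hA m (by omega) x.2 (by have := Finset.HasAntidiagonal.mem_antidiagonal.mp hx; omega)]

theorem coeff_prod_invFactor (b : ℕ+) (hb : 2 ≤ (b : ℕ)) (g : RatFunc L)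
    (hg : RatFunc.eval (RingHom.id L) 0 g = 1) (n m : ℕ) (hm : n + 1 ≤ m) :
    PowerSeries.coeff n (∏ k ∈ Finset.range m, invFactor b g k) =
      PowerSeries.coeff n (infProd b g) := by
  rw [infProd, PowerSeries.coeff_mk]
  refine coeff_prod_of_eq_one_mod (fun k hk i hi => ?_) m hm
  have hbk : i < (b : ℕ) ^ k := by
    have h1 : k < (b : ℕ) ^ k := Nat.lt_pow_self (by omega)
    omega
  simp only [RatFunc.eval, Polynomial.eval₂_id] at hg
  have hd : g.denom.eval 0 ≠ 0 := by
    intro h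
    simp [h] at hg
  have hnd : g.num.eval 0 = g.denom.eval 0 := by
    field_simp at hg
    exact hg
  rw [← Polynomial.coeff_zero_eq_eval_zero, ← Polynomial.coeff_zero_eq_eval_zero] at hnd
  rw [← Polynomial.coeff_zero_eq_eval_zero] at hd
  have hpos : 0 < (b : ℕ) ^ k := pow_pos b.pos k
  set N : PowerSeries L := ((expand L ((b : ℕ) ^ k) g.num : L[X]) : PowerSeries L) with hN
  set D : PowerSeries L := ((expand L ((b : ℕ) ^ k) g.denom : L[X]) : PowerSeries L) with hD
  have hN0 : PowerSeries.constantCoeff N ≠ 0 := by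
    rw [← PowerSeries.coeff_zero_eq_constantCoeff_apply, hN, Polynomial.coeff_coe,
      Polynomial.coeff_expand hpos]
    simpa [hnd] using hd
  have hdvd : (PowerSeries.X : PowerSeries L) ^ ((b : ℕ) ^ k) ∣ D - N := by
    rw [PowerSeries.X_pow_dvd_iff]
    intro l hl
    rw [map_sub, hN, hD, Polynomial.coeff_coe, Polynomial.coeff_coe,
      Polynomial.coeff_expand hpos, Polynomial.coeff_expand hpos]
    by_cases h0 : l = 0
    · simp [h0, hnd]
    · rw [if_neg (Nat.not_dvd_of_pos_of_lt (Nat.pos_of_ne_zero h0) hl),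
        if_neg (Nat.not_dvd_of_pos_of_lt (Nat.pos_of_ne_zero h0) hl), sub_zero]
  have hsub : invFactor b g k - 1 = (D - N) * N⁻¹ := by
    rw [invFactor, sub_mul, PowerSeries.mul_inv_cancel N hN0]
  have := (PowerSeries.X_pow_dvd_iff.mp (hsub ▸ hdvd.mul_right N⁻¹)) i hbk
  rw [map_sub, sub_eq_zero] at this
  exact this

/-- The data `(λ, g, (p_1, …, p_s))`. -/
structure NormalFormData (L : Type*) [Field L] where
  lam : Lˣ
  g : RatFunc L
  s : ℕ
  p : Fin s → LaurentPolynomial L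

/-- The generalized series `e(λ) p_j(x^{1/q}) ∏_{k ≥ 0} 1 / g(x^{b^k/q})`. -/
def NormalFormData.basisElt (t : NormalFormData L) (b q : ℕ+) (j : Fin t.s) : GenSeries L :=
  expo t.lam (ramify q (laurentPolyToSeries (t.p j) *
    HahnSeries.ofPowerSeries ℤ L (infProd b t.g)))

/-- The family `p` is in reduced echelon form with respect to ascending degree: `v j` is the
valuation of `p j`, the valuations increase strictly, the coefficient of `p j` at `v j` is `1`, and
the coefficients of the other members at `v j` vanish. -/
def IsReducedEchelon {s : ℕ} (p : Fin s → LaurentPolynomial L) : Prop :=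
  ∃ v : Fin s → ℤ, StrictMono v ∧ (∀ j, ∀ n < v j, (p j).coeff n = 0) ∧
    ∀ i j, (p i).coeff (v j) = if i = j then 1 else 0

/-- The common divisors of the members of the family are units of the ring of Laurent
polynomials. -/
def IsCoprimeFamily {s : ℕ} (p : Fin s → LaurentPolynomial L) : Prop :=
  ∀ d : LaurentPolynomial L, (∀ j, d ∣ p j) → IsUnit d

end NormalForm

end Mahler

end

/-!
If `λ * w(x ^ b) = μ * w(x)` with `w ≠ 0`, then `w` has order `0` and `λ = μ`. Applied to the
quotient of two coefficients of a hypergeometric element, this shows that such an element has only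
one nonzero coefficient, so it is `e(λ) p` for a Puiseux series `p`.

Suppose that `e(λ) p` is a solution of the equation. If `b` were not coprime to the denominator of
some exponent of `p`, then comparing the coefficients of the equation at a suitable exponent would
produce an exponent with a larger denominator of the same kind, and so on without bound. So these
denominators are coprime to `b`, and the terms of `p` whose exponents have a given denominator form
again a solution. Its order is the opposite of the slope of a `λ`-admissible edge, hence the
denominator divides `q_λ`, and the orders of the solutions take finitely many values.

It follows that `𝔥` consists of the series `e(λ) f(x ^ (1 / q_λ))` with `f` in a finite-dimensional
space `V` contained in `L(x) f₀`. The `L[x, x⁻¹]`-module generated by `V` is finitely generated of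
rank one over a principal ideal domain, hence cyclic. A generator is unique up to a factor
`c * x ^ n`, so exactly one generator `φ` is a power series with constant term `1`, and the rational
function `g(x) = φ(x ^ b) / φ(x)` determines it as the product of the `1 / g(x ^ (b ^ k))`. The
`p_j` are the reduced echelon basis of the space of those `p` with `p φ ∈ V`, and they are coprime
because `V` generates the same module as `φ`.
-/

noncomputable section

namespace Mahler

section Coefficients

variable {K F : Type*} [Field K] [Field F] [Algebra K F] (b : ℕ+) {r : ℕ}
  (ℓ : Fin (r + 1) → K[X])

/-- The operator `∑ k, ℓ k * mu ^ k * M ^ k` on formal series `∑ a, c a * x ^ a` with rational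
exponents, described on their families of coefficients. No condition on the supports is needed,
because every coefficient of the result is a finite sum. -/
def coeffOp (mu : F) : (ℚ → F) →ₗ[F] ℚ → F :=
  ∑ k : Fin (r + 1), ∑ m ∈ (ℓ k).support, (algebraMap K F ((ℓ k).coeff m) * mu ^ (k : ℕ)) •
    LinearMap.funLeft F F fun a => (a - m) / ((b : ℕ) : ℚ) ^ (k : ℕ)

theorem coeffOp_apply (mu : F) (c : ℚ → F) (a : ℚ) :
    coeffOp b ℓ mu c a = ∑ k : Fin (r + 1), ∑ m ∈ (ℓ k).support,
      algebraMap K F ((ℓ k).coeff m) * mu ^ (k : ℕ) *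
        c ((a - m) / ((b : ℕ) : ℚ) ^ (k : ℕ)) := by
  simp [coeffOp, LinearMap.funLeft]

/-- The ordinate at abscissa `0` of the line of slope `-v` through the lowest point of the Newton
diagram at abscissa `b ^ k`. -/
def intercept (v : ℚ) (k : Fin (r + 1)) : ℚ :=
  (ℓ k).natTrailingDegree + v * ((b : ℕ) : ℚ) ^ (k : ℕ)

open scoped Classical in
/-- The indices `k` such that the lowest point at abscissa `b ^ k` lies on the supporting line of
slope `-v` of the lower Newton polygon. -/
def lowerFace (v : ℚ) : Finset (Fin (r + 1)) :=
  {k | ℓ k ≠ 0 ∧ ∀ j, ℓ j ≠ 0 → intercept b ℓ v k ≤ intercept b ℓ v j}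

variable {b ℓ} {v : ℚ} {i j k : Fin (r + 1)}

theorem mem_lowerFace :
    k ∈ lowerFace b ℓ v ↔ ℓ k ≠ 0 ∧ ∀ j, ℓ j ≠ 0 → intercept b ℓ v k ≤ intercept b ℓ v j := by
  simp [lowerFace]

theorem mem_lowerFace_iff_intercept_eq (hi : i ∈ lowerFace b ℓ v) (hk : ℓ k ≠ 0) :
    k ∈ lowerFace b ℓ v ↔ intercept b ℓ v k = intercept b ℓ v i := by
  rw [mem_lowerFace] at hi ⊢
  exact ⟨fun h => le_antisymm (h.2 i hi.1) (hi.2 k hk), fun h => ⟨hk, h ▸ hi.2⟩⟩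

theorem lowerFace_nonempty (hℓ : ℓ ≠ 0) : (lowerFace b ℓ v).Nonempty := by
  classical
  obtain ⟨k, hk⟩ := Function.ne_iff.mp hℓ
  obtain ⟨i, hi, hmin⟩ := Finset.exists_min_image {i | ℓ i ≠ 0} (intercept b ℓ v)
    ⟨k, by simpa using hk⟩
  exact ⟨i, mem_lowerFace.mpr ⟨by simpa using hi, by simpa using hmin⟩⟩

theorem coeffOp_intercept {mu : F} {c : ℚ → F} (hc : ∀ a < v, c a = 0)
    (hi : i ∈ lowerFace b ℓ v) :
    coeffOp b ℓ mu c (intercept b ℓ v i) =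
      (∑ k ∈ lowerFace b ℓ v, algebraMap K F (ℓ k).trailingCoeff * mu ^ (k : ℕ)) * c v := by
  have hpos (k : ℕ) : (0 : ℚ) < ((b : ℕ) : ℚ) ^ k := by positivity
  have hvanish {k : Fin (r + 1)} {m : ℕ}
      (h : intercept b ℓ v i < m + v * ((b : ℕ) : ℚ) ^ (k : ℕ)) :
      c ((intercept b ℓ v i - m) / ((b : ℕ) : ℚ) ^ (k : ℕ)) = 0 :=
    hc _ (by rw [div_lt_iff₀ (hpos k)]; linarith)
  rw [coeffOp_apply, Finset.sum_mul, ← Finset.sum_subset (Finset.subset_univ (lowerFace b ℓ v))]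
  · refine Finset.sum_congr rfl fun k hk => ?_
    have hk₀ := (mem_lowerFace.mp hk).1
    have hki := (mem_lowerFace_iff_intercept_eq hi hk₀).mp hk
    rw [Finset.sum_eq_single_of_mem _ (natTrailingDegree_mem_support_of_nonzero hk₀)]
    · rw [← hki, intercept, add_sub_cancel_left, mul_div_cancel_right₀ v (hpos k).ne',
        trailingCoeff]
    · intro m hm hne
      have hlt : ((ℓ k).natTrailingDegree : ℚ) < m := by
        exact_mod_cast (natTrailingDegree_le_of_mem_supp m hm).lt_of_ne' hne
      rw [hvanish (by rw [← hki, intercept]; linarith), mul_zero]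
  · intro k _ hk
    refine Finset.sum_eq_zero fun m hm => ?_
    have hk₀ : ℓ k ≠ 0 := by rintro h; simp [h] at hm
    have hlt := ((mem_lowerFace.mp hi).2 k hk₀).lt_of_ne'
      (mt (mem_lowerFace_iff_intercept_eq hi hk₀).mpr hk)
    have hle : ((ℓ k).natTrailingDegree : ℚ) ≤ m := by
      exact_mod_cast natTrailingDegree_le_of_mem_supp m hm
    rw [hvanish (hlt.trans_le (by rw [intercept]; linarith)), mul_zero]

theorem edgeSlope_eq_neg (hb : 2 ≤ (b : ℕ)) (hi : i ∈ lowerFace b ℓ v)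
    (hj : j ∈ lowerFace b ℓ v) (hij : i < j) : edgeSlope b ℓ i j = -v := by
  have hpow : ((b : ℕ) : ℚ) ^ (i : ℕ) < ((b : ℕ) : ℚ) ^ (j : ℕ) :=
    pow_lt_pow_right₀ (by exact_mod_cast hb) hij
  have hint := (mem_lowerFace_iff_intercept_eq hi (mem_lowerFace.mp hj).1).mp hj
  rw [intercept, intercept] at hint
  rw [edgeSlope, div_eq_iff (sub_pos.mpr hpow).ne']
  linarith

theorem edgeHeight_eq (hb : 2 ≤ (b : ℕ)) (hi : i ∈ lowerFace b ℓ v)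
    (hj : j ∈ lowerFace b ℓ v) (hij : i < j) (k : Fin (r + 1)) :
    edgeHeight b ℓ i j k = intercept b ℓ v i - v * ((b : ℕ) : ℚ) ^ (k : ℕ) := by
  rw [edgeHeight, edgeSlope_eq_neg hb hi hj hij, intercept]
  ring

theorem natTrailingDegree_eq_edgeHeight_iff (hb : 2 ≤ (b : ℕ)) (hi : i ∈ lowerFace b ℓ v)
    (hj : j ∈ lowerFace b ℓ v) (hij : i < j) (hk : ℓ k ≠ 0) :
    ((ℓ k).natTrailingDegree : ℚ) = edgeHeight b ℓ i j k ↔ k ∈ lowerFace b ℓ v := by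
  rw [mem_lowerFace_iff_intercept_eq hi hk, edgeHeight_eq hb hi hj hij, eq_sub_iff_add_eq]
  rfl

theorem isLowerEdge_of_isLeast_of_isGreatest (hb : 2 ≤ (b : ℕ))
    (hi : IsLeast (lowerFace b ℓ v : Set (Fin (r + 1))) i)
    (hj : IsGreatest (lowerFace b ℓ v : Set (Fin (r + 1))) j) (hij : i < j) :
    IsLowerEdge b ℓ i j := by
  have hi' := mem_lowerFace.mp hi.1
  refine ⟨hij, hi'.1, (mem_lowerFace.mp hj.1).1, fun k hk => ⟨?_, fun h => ?_⟩⟩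
  · rw [edgeHeight_eq hb hi.1 hj.1 hij, sub_le_iff_le_add]
    exact hi'.2 k hk
  · have hkface := (natTrailingDegree_eq_edgeHeight_iff hb hi.1 hj.1 hij hk).mp h
    exact ⟨hi.2 hkface, hj.2 hkface⟩

theorem pow_mul_aeval_edgeCharPoly (hb : 2 ≤ (b : ℕ))
    (hi : IsLeast (lowerFace b ℓ v : Set (Fin (r + 1))) i)
    (hj : IsGreatest (lowerFace b ℓ v : Set (Fin (r + 1))) j) (hij : i < j) (mu : F) :
    mu ^ (i : ℕ) * aeval mu (edgeCharPoly b ℓ i j) =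
      ∑ k ∈ lowerFace b ℓ v, algebraMap K F (ℓ k).trailingCoeff * mu ^ (k : ℕ) := by
  have hface {k : Fin (r + 1)} (hk : ℓ k ≠ 0) :=
    natTrailingDegree_eq_edgeHeight_iff hb hi.1 hj.1 hij hk
  rw [edgeCharPoly, map_sum, Finset.mul_sum, ← Finset.sum_subset (s₁ := lowerFace b ℓ v)]
  · refine Finset.sum_congr rfl fun k hk => ?_
    have hik : (i : ℕ) ≤ k := hi.2 hk
    rw [if_pos ((hface (mem_lowerFace.mp hk).1).mpr hk), aeval_monomial, mul_left_comm, ← pow_add,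
      Nat.add_sub_cancel' hik]
  · exact fun k hk => Finset.mem_Icc.mpr ⟨hi.2 hk, hj.2 hk⟩
  · intro k _ hk
    by_cases hk₀ : ℓ k = 0
    · simp [hk₀]
    · rw [if_neg (mt (hface hk₀).mp hk), map_zero, mul_zero]

theorem nontrivial_lowerFace_of_sum_eq_zero (hℓ : ℓ ≠ 0) {mu : F} (hmu : mu ≠ 0)
    (hsum : ∑ k ∈ lowerFace b ℓ v, algebraMap K F (ℓ k).trailingCoeff * mu ^ (k : ℕ) = 0) :
    (lowerFace b ℓ v).Nontrivial := by
  obtain ⟨i, hi⟩ := lowerFace_nonempty (b := b) (v := v) hℓ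
  rw [← Finset.one_lt_card_iff_nontrivial]
  by_contra! hcard
  have hface : lowerFace b ℓ v = {i} :=
    Finset.eq_singleton_iff_unique_mem.mpr ⟨hi, fun k hk => Finset.card_le_one.mp hcard k hk i hi⟩
  rw [hface, Finset.sum_singleton] at hsum
  have htc : (ℓ i).trailingCoeff ≠ 0 :=
    trailingCoeff_nonzero_iff_nonzero.mpr (mem_lowerFace.mp hi).1
  exact mul_ne_zero ((_root_.map_ne_zero _).mpr htc) (pow_ne_zero _ hmu) hsum

theorem exists_isAdmissibleEdge_of_coeffOp_eq_zero (hb : 2 ≤ (b : ℕ)) (hℓ : ℓ ≠ 0) {mu : F}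
    (hmu : mu ≠ 0) {c : ℚ → F} (hv : IsLeast (Function.support c) v)
    (hc : coeffOp b ℓ mu c = 0) :
    ∃ i j, IsAdmissibleEdge b ℓ mu i j ∧ edgeSlope b ℓ i j = -v := by
  have hne := lowerFace_nonempty (b := b) (v := v) hℓ
  have hlt : ∀ a < v, c a = 0 := fun a ha => by_contra fun h => ha.not_ge (hv.2 h)
  have hsum := coeffOp_intercept (mu := mu) hlt hne.choose_spec
  rw [hc, Pi.zero_apply, eq_comm] at hsum
  replace hsum := (mul_eq_zero.mp hsum).resolve_right hv.1
  have hij := Finset.min'_lt_max'_of_card _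
    (Finset.one_lt_card_iff_nontrivial.mpr (nontrivial_lowerFace_of_sum_eq_zero hℓ hmu hsum))
  have hi := (lowerFace b ℓ v).isLeast_min' hne
  have hj := (lowerFace b ℓ v).isGreatest_max' hne
  refine ⟨_, _, ⟨isLowerEdge_of_isLeast_of_isGreatest hb hi hj hij, ?_⟩,
    edgeSlope_eq_neg hb hi.1 hj.1 hij⟩
  rw [← pow_mul_aeval_edgeCharPoly hb hi hj hij] at hsum
  exact (mul_eq_zero.mp hsum).resolve_left (pow_ne_zero _ hmu)

end Coefficients

section Denominators

variable {K F : Type*} [Field K] [Field F] [Algebra K F] {b : ℕ+} {r : ℕ}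
  {ℓ : Fin (r + 1) → K[X]} {mu : F} {c : ℚ → F}

theorem den_natCast_mul (n : ℕ) (x : ℚ) : ((n : ℚ) * x).den = x.den / n.gcd x.den := by
  rw [Rat.mul_den, Rat.den_natCast, Rat.num_natCast, one_mul, Int.natAbs_mul, Int.natAbs_natCast,
    x.reduced.gcd_mul_right_cancel]

theorem den_eq_den_sub_div_pow_div_gcd (b : ℕ+) (k m : ℕ) (a : ℚ) :
    a.den = ((a - m) / ((b : ℕ) : ℚ) ^ k).den /
      ((b : ℕ) ^ k).gcd ((a - m) / ((b : ℕ) : ℚ) ^ k).den := by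
  have hb : ((b : ℕ) : ℚ) ^ k ≠ 0 := by positivity
  rw [← den_natCast_mul, Nat.cast_pow, mul_div_cancel₀ _ hb, Rat.sub_natCast_den]

theorem den_sub_div_pow_of_coprime {k m : ℕ} {a : ℚ}
    (h : (b : ℕ).Coprime ((a - m) / ((b : ℕ) : ℚ) ^ k).den) :
    ((a - m) / ((b : ℕ) : ℚ) ^ k).den = a.den := by
  rw [den_eq_den_sub_div_pow_div_gcd b k m a, h.pow_left k, Nat.div_one]

theorem den_lt_den_sub_div_pow {k m : ℕ} {a : ℚ} (hk : k ≠ 0)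
    (h : ¬ (b : ℕ).Coprime ((a - m) / ((b : ℕ) : ℚ) ^ k).den) :
    a.den < ((a - m) / ((b : ℕ) : ℚ) ^ k).den := by
  have hgcd := mt (Nat.coprime_pow_left_iff (Nat.pos_of_ne_zero hk) _ _).mp h
  have hpos := Nat.gcd_pos_of_pos_right ((b : ℕ) ^ k) ((a - m) / ((b : ℕ) : ℚ) ^ k).den_pos
  rw [den_eq_den_sub_div_pow_div_gcd b k m a]
  exact Nat.div_lt_self (Rat.den_pos _) (by rw [Nat.coprime_iff_gcd_eq_one] at hgcd; omega)

theorem exists_den_lt_of_coeffOp_eq_zero (hℓ₀ : ℓ 0 ≠ 0) (hwf : c.support.IsWF)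
    (hc : coeffOp b ℓ mu c = 0) {a : ℚ} (ha : c a ≠ 0) (hab : ¬ (b : ℕ).Coprime a.den) :
    ∃ a', c a' ≠ 0 ∧ ¬ (b : ℕ).Coprime a'.den ∧ a.den < a'.den := by
  by_contra! hmax
  have hwf' : (c.support ∩ {x | x.den = a.den}).IsWF := hwf.mono Set.inter_subset_left
  have hne : (c.support ∩ {x | x.den = a.den}).Nonempty := ⟨a, ha, rfl⟩
  obtain ⟨hvc, hvd : (hwf'.min hne).den = a.den⟩ := hwf'.min_mem hne
  set v := hwf'.min hne
  have hlt {y : ℚ} (hy : y < v) (hyd : y.den = a.den) : c y = 0 :=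
    by_contra fun hyc => hwf'.not_lt_min hne ⟨hyc, hyd⟩ hy
  have hden : ((ℓ 0).natTrailingDegree + v : ℚ).den = a.den := by
    rw [Rat.natCast_add_den, hvd]
  have hcoeff := congr_fun hc ((ℓ 0).natTrailingDegree + v)
  rw [coeffOp_apply, Pi.zero_apply, Finset.sum_eq_single_of_mem 0 (Finset.mem_univ _),
    Finset.sum_eq_single_of_mem _ (natTrailingDegree_mem_support_of_nonzero hℓ₀)] at hcoeff
  · simp only [Fin.val_zero, pow_zero, div_one, mul_one, add_sub_cancel_left, mul_eq_zero,
      map_eq_zero] at hcoeff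
    exact hcoeff.elim (trailingCoeff_nonzero_iff_nonzero.mpr hℓ₀) hvc
  · intro m hm hne'
    have hlt' : ((ℓ 0).natTrailingDegree : ℚ) < m := by
      exact_mod_cast (natTrailingDegree_le_of_mem_supp m hm).lt_of_ne' hne'
    rw [Fin.val_zero, pow_zero, pow_zero, div_one,
      hlt (by linarith) (by rw [Rat.sub_natCast_den, hden]), mul_zero]
  · intro k _ hk
    refine Finset.sum_eq_zero fun m _ => by_contra fun hne' => ?_
    by_cases hcop : (b : ℕ).Coprime
        (((ℓ 0).natTrailingDegree + v - m) / ((b : ℕ) : ℚ) ^ (k : ℕ)).den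
    · exact hab (hden ▸ den_sub_div_pow_of_coprime hcop ▸ hcop)
    · have hden_lt := den_lt_den_sub_div_pow (Fin.val_ne_zero_iff.mpr hk) hcop
      exact (hden ▸ hden_lt).not_ge (hmax _ (right_ne_zero_of_mul hne') hcop)

theorem coprime_den_of_coeffOp_eq_zero (hℓ₀ : ℓ 0 ≠ 0) (hwf : c.support.IsWF) {N : ℕ}
    (hN : ∀ a, c a ≠ 0 → a.den ≤ N) (hc : coeffOp b ℓ mu c = 0) {a : ℚ} (ha : c a ≠ 0) :
    (b : ℕ).Coprime a.den := by
  by_contra hab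
  have hunbounded (n : ℕ) : ∃ a, c a ≠ 0 ∧ ¬ (b : ℕ).Coprime a.den ∧ n ≤ a.den := by
    induction n with
    | zero => exact ⟨a, ha, hab, Nat.zero_le _⟩
    | succ n ih =>
      obtain ⟨x, hx, hxb, hnx⟩ := ih
      obtain ⟨y, hy, hyb, hxy⟩ := exists_den_lt_of_coeffOp_eq_zero hℓ₀ hwf hc hx hxb
      exact ⟨y, hy, hyb, hnx.trans_lt hxy⟩
  obtain ⟨x, hx, -, hNx⟩ := hunbounded (N + 1)
  exact (hN x hx).not_gt hNx

theorem coeffOp_indicator_den (hc : ∀ a, c a ≠ 0 → (b : ℕ).Coprime a.den) (d : ℕ) :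
    coeffOp b ℓ mu ({a | a.den = d}.indicator c) =
      {a | a.den = d}.indicator (coeffOp b ℓ mu c) := by
  ext a
  have hterm (k m : ℕ) : {a | a.den = d}.indicator c ((a - m) / ((b : ℕ) : ℚ) ^ k) =
      if a.den = d then c ((a - m) / ((b : ℕ) : ℚ) ^ k) else 0 := by
    by_cases h : c ((a - m) / ((b : ℕ) : ℚ) ^ k) = 0
    · rw [h, ite_self, Set.indicator_apply_eq_zero]
      exact fun _ => h
    · simp only [Set.indicator_apply, Set.mem_ofPred_eq, den_sub_div_pow_of_coprime (hc _ h)]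
  simp only [coeffOp_apply, hterm, Set.indicator_apply, Set.mem_ofPred_eq]
  split_ifs <;> simp

theorem den_dvd_ramBound (hb : 2 ≤ (b : ℕ)) (hℓ₀ : ℓ 0 ≠ 0) (hmu : mu ≠ 0)
    (hwf : c.support.IsWF) {N : ℕ} (hN : ∀ a, c a ≠ 0 → a.den ≤ N)
    (hc : coeffOp b ℓ mu c = 0) {a : ℚ} (ha : c a ≠ 0) : a.den ∣ ramBound b ℓ mu := by
  classical
  have hcop (x : ℚ) (hx : c x ≠ 0) := coprime_den_of_coeffOp_eq_zero hℓ₀ hwf hN hc hx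
  have hsupp : ({x | x.den = a.den}.indicator c).support = {x | x.den = a.den} ∩ c.support :=
    Set.support_indicator
  have hwf' : ({x | x.den = a.den}.indicator c).support.IsWF :=
    hwf.mono (hsupp ▸ Set.inter_subset_right)
  have hne : ({x | x.den = a.den}.indicator c).support.Nonempty := hsupp ▸ ⟨a, rfl, ha⟩
  obtain ⟨i, j, hadm, hslope⟩ := exists_isAdmissibleEdge_of_coeffOp_eq_zero hb
    (Function.ne_iff.mpr ⟨0, hℓ₀⟩) hmu ⟨hwf'.min_mem hne, fun x hx => hwf'.min_le hne hx⟩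
    (by rw [coeffOp_indicator_den hcop, hc, Set.indicator_zero'])
  have hden : (edgeSlope b ℓ i j).den = a.den := by
    rw [hslope, Rat.neg_den]
    exact (hsupp.subset (hwf'.min_mem hne)).1
  rw [← hden]
  exact Finset.dvd_lcm (f := fun e : Fin (r + 1) × Fin (r + 1) => (edgeSlope b ℓ e.1 e.2).den)
    (b := (i, j)) (by simpa [hden] using ⟨hadm, hcop a ha⟩)

end Denominators

section PuiseuxCoefficients

variable {F : Type*} [Field F]

theorem coe_ramify (q : ℕ+) (f : LaurentSeries F) :
    (ramify q f : HahnSeries ℚ F) = hahnRamify F q f := rfl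

theorem coe_mahlerPuiseux (b : ℕ+) (p : Puiseux F) :
    (mahlerPuiseux b p : HahnSeries ℚ F) = hahnExpand F b p := rfl

theorem coeff_hahnExpand (b : ℕ+) (f : HahnSeries ℚ F) (a : ℚ) :
    (hahnExpand F b f).coeff a = f.coeff (a / (b : ℕ)) := by
  have hb : ((b : ℕ) : ℚ) ≠ 0 := by exact_mod_cast b.ne_zero
  conv_lhs => rw [← mul_div_cancel₀ a hb]
  exact HahnSeries.embDomain_mk_coeff (f := fun k : ℚ => ((b : ℕ) : ℚ) * k) _ _

theorem coeff_mahlerPuiseux_iterate (b : ℕ+) (k : ℕ) (p : Puiseux F) (a : ℚ) :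
    (((mahlerPuiseux b)^[k] p : Puiseux F) : HahnSeries ℚ F).coeff a =
      (p : HahnSeries ℚ F).coeff (a / ((b : ℕ) : ℚ) ^ k) := by
  induction k generalizing p with
  | zero => simp
  | succ k ih =>
    rw [Function.iterate_succ_apply, ih, coe_mahlerPuiseux, coeff_hahnExpand, div_div, pow_succ]

theorem coeff_hahnRamify (q : ℕ+) (f : LaurentSeries F) (n : ℤ) :
    (hahnRamify F q f).coeff (n / (q : ℕ)) = f.coeff n :=
  HahnSeries.embDomain_mk_coeff (f := fun n : ℤ => (n : ℚ) / (q : ℕ)) _ _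

theorem exists_eq_div_of_coeff_hahnRamify_ne_zero {q : ℕ+} {f : LaurentSeries F} {a : ℚ}
    (h : (hahnRamify F q f).coeff a ≠ 0) : ∃ n : ℤ, (n : ℚ) / (q : ℕ) = a := by
  by_contra hn
  exact h (HahnSeries.embDomain_of_notMem_range hn)

theorem hahnRamify_single (q : ℕ+) (n : ℤ) (c : F) :
    hahnRamify F q (HahnSeries.single n c) = HahnSeries.single ((n : ℚ) / (q : ℕ)) c :=
  HahnSeries.embDomain_single

theorem hahnRamify_C (q : ℕ+) (c : F) : hahnRamify F q (HahnSeries.C c) = HahnSeries.C c :=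
  HahnSeries.embDomainRingHom_C

theorem coe_algebraMap_puiseux (c : F) :
    (algebraMap F (Puiseux F) c : HahnSeries ℚ F) = HahnSeries.C c :=
  hahnRamify_C 1 c

theorem coe_smul_puiseux (c : F) (p : Puiseux F) :
    ((c • p : Puiseux F) : HahnSeries ℚ F) = c • (p : HahnSeries ℚ F) := by
  rw [Algebra.smul_def, Subfield.coe_mul, coe_algebraMap_puiseux, HahnSeries.C_mul_eq_smul]

theorem ramify_smul (q : ℕ+) (c : F) (f : LaurentSeries F) :
    ramify q (c • f) = c • ramify q f := by
  apply Subtype.ext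
  rw [coe_smul_puiseux, coe_ramify, coe_ramify, ← HahnSeries.C_mul_eq_smul, map_mul, hahnRamify_C,
    HahnSeries.C_mul_eq_smul]

theorem mahlerPuiseux_smul (b : ℕ+) (c : F) (p : Puiseux F) :
    mahlerPuiseux b (c • p) = c • mahlerPuiseux b p := by
  apply Subtype.ext
  rw [coe_smul_puiseux, coe_mahlerPuiseux, coe_mahlerPuiseux, coe_smul_puiseux,
    ← HahnSeries.C_mul_eq_smul, map_mul, ← HahnSeries.C_mul_eq_smul]
  congr 1
  exact HahnSeries.embDomainRingHom_C

theorem mahlerPuiseux_ramify (b q : ℕ+) (f : LaurentSeries F) :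
    mahlerPuiseux b (ramify q f) = ramify q (laurentExpand F b f) :=
  Subtype.ext (hahnExpand_hahnRamify b q f)

theorem ramify_mul_expand (q n : ℕ+) (f : LaurentSeries F) :
    ramify (q * n) (laurentExpand F n f) = ramify q f :=
  Subtype.ext (hahnRamify_mul_expand q n f)

theorem coeff_polyRamify_mul (q : ℕ+) (A : F[X]) (p : Puiseux F) (a : ℚ) :
    ((polyRamify q A * p : Puiseux F) : HahnSeries ℚ F).coeff a =
      ∑ m ∈ A.support, A.coeff m * (p : HahnSeries ℚ F).coeff (a - m / (q : ℕ)) := by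
  have hsum : (polyRamify q A : HahnSeries ℚ F) =
      ∑ m ∈ A.support, HahnSeries.single ((m : ℚ) / (q : ℕ)) (A.coeff m) := by
    conv_lhs => rw [A.as_sum_support]
    rw [polyRamify, coe_ramify, ← Polynomial.coeToPowerSeries.ringHom_apply, map_sum, map_sum,
      map_sum]
    refine Finset.sum_congr rfl fun m _ => ?_
    rw [Polynomial.coeToPowerSeries.ringHom_apply, ← C_mul_X_pow_eq_monomial, coe_mul, coe_C,
      coe_pow, coe_X, map_mul, HahnSeries.ofPowerSeries_C, HahnSeries.ofPowerSeries_X_pow,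
      HahnSeries.C_apply, HahnSeries.single_mul_single, zero_add, mul_one, hahnRamify_single,
      Int.cast_natCast]
  rw [Subfield.coe_mul, hsum, Finset.sum_mul, HahnSeries.coeff_sum]
  exact Finset.sum_congr rfl fun m _ => HahnSeries.coeff_single_mul

theorem den_dvd_iff_exists_div_eq (q : ℕ+) (a : ℚ) :
    a.den ∣ q ↔ ∃ n : ℤ, (n : ℚ) / (q : ℕ) = a := by
  constructor
  · rintro ⟨d, hd⟩
    have hd₀ : (d : ℚ) ≠ 0 := by
      rintro h
      rw [Nat.cast_eq_zero.mp h, mul_zero] at hd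
      exact q.ne_zero hd
    refine ⟨a.num * d, ?_⟩
    rw [hd]
    push_cast
    rw [mul_div_mul_right _ _ hd₀, Rat.num_div_den]
  · rintro ⟨n, rfl⟩
    have h := Rat.den_dvd n (q : ℕ)
    rw [Rat.divInt_eq_div] at h
    exact_mod_cast h

theorem isLeast_support_coeff_order {Γ R : Type*} [LinearOrder Γ] [Zero Γ] [Zero R]
    {f : HahnSeries Γ R} (hf : f ≠ 0) : IsLeast (Function.support f.coeff) f.order :=
  ⟨fun h => hf (HahnSeries.coeff_order_eq_zero.mp h),
    fun _ h => HahnSeries.order_le_of_coeff_ne_zero h⟩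

theorem isWF_support_coeff (f : HahnSeries ℚ F) : f.coeff.support.IsWF := f.isPWO_support.isWF

theorem exists_den_le (p : Puiseux F) :
    ∃ N : ℕ, ∀ a, (p : HahnSeries ℚ F).coeff a ≠ 0 → a.den ≤ N := by
  obtain ⟨_, q, f, rfl⟩ := p
  exact ⟨q, fun a ha => Nat.le_of_dvd q.pos
    ((den_dvd_iff_exists_div_eq q a).mpr (exists_eq_div_of_coeff_hahnRamify_ne_zero ha))⟩

theorem mem_range_ramify_iff (q : ℕ+) (p : Puiseux F) :
    p ∈ Set.range (ramify q) ↔ ∀ a, (p : HahnSeries ℚ F).coeff a ≠ 0 → a.den ∣ q := by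
  refine ⟨?_, fun h => ?_⟩
  · rintro ⟨f, rfl⟩ a ha
    exact (den_dvd_iff_exists_div_eq q a).mpr (exists_eq_div_of_coeff_hahnRamify_ne_zero ha)
  have hmono : StrictMono fun n : ℤ => (n : ℚ) / (q : ℕ) := fun m n hmn =>
    div_lt_div_of_pos_right (by exact_mod_cast hmn) (by exact_mod_cast q.pos)
  have hpwo : (Function.support fun n : ℤ =>
      (p : HahnSeries ℚ F).coeff ((n : ℚ) / (q : ℕ))).IsPWO := by
    rw [Set.isPWO_iff_isWF, Set.isWF_iff_no_descending_seq]
    exact fun u hu hmem => Set.isWF_iff_no_descending_seq.mp (isWF_support_coeff _) _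
      (fun m n hmn => hmono (hu hmn)) hmem
  refine ⟨⟨_, hpwo⟩, Subtype.ext (HahnSeries.ext (funext fun a => ?_))⟩
  rw [coe_ramify]
  by_cases ha : ∃ n : ℤ, (n : ℚ) / (q : ℕ) = a
  · obtain ⟨n, rfl⟩ := ha
    rw [coeff_hahnRamify]
  · rw [not_imp_comm.mp (h a) (mt (den_dvd_iff_exists_div_eq q a).mp ha)]
    exact not_imp_comm.mp exists_eq_div_of_coeff_hahnRamify_ne_zero ha

end PuiseuxCoefficients

section GenSeries

variable {F : Type*} [Field F]

theorem expo_inj {mu nu : Fˣ} {p p' : Puiseux F} (hp : p ≠ 0) :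
    expo mu p = expo nu p' ↔ mu = nu ∧ p = p' := by
  simp [expo, MonoidAlgebra.single_inj, hp]

theorem smul_expo {S : Type*} [SMulZeroClass S (Puiseux F)] (u : S) (mu : Fˣ) (p : Puiseux F) :
    u • expo mu p = expo mu (u • p) :=
  MonoidAlgebra.smul_single ..

theorem coeff_mahler (b : ℕ+) (y : GenSeries F) (mu : Fˣ) :
    (mahler b y).coeff mu = (mu : F) • mahlerPuiseux b (y.coeff mu) := by
  classical
  induction y using MonoidAlgebra.induction_linear with
  | zero => simp
  | add f g hf hg => simp [hf, hg]
  | single nu p =>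
    rw [← expo, mahler_expo]
    obtain rfl | h := eq_or_ne nu mu <;> simp_all [expo]

theorem mahler_iterate_expo (b : ℕ+) (k : ℕ) (mu : Fˣ) (p : Puiseux F) :
    (mahler b)^[k] (expo mu p) = expo mu ((mu : F) ^ k • (mahlerPuiseux b)^[k] p) := by
  induction k with
  | zero => simp
  | succ k ih =>
    rw [Function.iterate_succ_apply', ih, mahler_expo, mahlerPuiseux_smul, smul_smul, ← pow_succ',
      ← Function.iterate_succ_apply' (mahlerPuiseux b)]

variable {K : Type*} [Field K] [Algebra K F]

theorem applyOp_expo (b : ℕ+) {r : ℕ} (ℓ : Fin (r + 1) → K[X]) (mu : Fˣ) (p : Puiseux F) :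
    applyOp b ℓ (expo mu p) = expo mu (∑ k : Fin (r + 1),
      polyRamify 1 ((ℓ k).map (algebraMap K F)) *
        ((mu : F) ^ (k : ℕ) • (mahlerPuiseux b)^[(k : ℕ)] p)) := by
  simp only [applyOp, mahler_iterate_expo, smul_expo, smul_eq_mul]
  exact (map_sum (MonoidAlgebra.singleAddHom mu) _ _).symm

theorem applyOp_expo_eq_zero_iff (b : ℕ+) {r : ℕ} (ℓ : Fin (r + 1) → K[X]) (mu : Fˣ)
    (p : Puiseux F) :
    applyOp b ℓ (expo mu p) = 0 ↔ coeffOp b ℓ (mu : F) (p : HahnSeries ℚ F).coeff = 0 := by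
  rw [applyOp_expo, expo, MonoidAlgebra.single_eq_zero, Subtype.ext_iff, HahnSeries.ext_iff]
  refine Eq.congr (funext fun a => ?_) rfl
  rw [AddSubmonoidClass.coe_finsetSum, HahnSeries.coeff_sum, coeffOp_apply]
  refine Finset.sum_congr rfl fun k _ => ?_
  rw [coeff_polyRamify_mul, Polynomial.support_map_of_injective _ (algebraMap K F).injective]
  refine Finset.sum_congr rfl fun m _ => ?_
  rw [coe_smul_puiseux, HahnSeries.coeff_smul, coeff_mahlerPuiseux_iterate, Polynomial.coeff_map,
    PNat.one_coe, Nat.cast_one, div_one, smul_eq_mul, mul_assoc]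

end GenSeries

section LaurentExpand

variable {F : Type*} [Field F]

theorem coeff_laurentExpand_mul (n : ℕ+) (f : LaurentSeries F) (k : ℤ) :
    (laurentExpand F n f).coeff (((n : ℕ) : ℤ) * k) = f.coeff k :=
  HahnSeries.embDomain_mk_coeff (f := fun k : ℤ => ((n : ℕ) : ℤ) * k) _ _

theorem coeff_laurentExpand_of_not_dvd (n : ℕ+) (f : LaurentSeries F) {k : ℤ}
    (h : ¬ ((n : ℕ) : ℤ) ∣ k) : (laurentExpand F n f).coeff k = 0 :=
  HahnSeries.embDomain_of_notMem_range fun ⟨m, hm⟩ => h ⟨m, hm.symm⟩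

theorem laurentExpand_single (n : ℕ+) (k : ℤ) (c : F) :
    laurentExpand F n (HahnSeries.single k c) = HahnSeries.single (((n : ℕ) : ℤ) * k) c :=
  HahnSeries.embDomain_single

theorem algebraMap_monomial (m : ℕ) (c : F) :
    algebraMap F[X] (LaurentSeries F) (monomial m c) = HahnSeries.single (m : ℤ) c := by
  rw [← C_mul_X_pow_eq_monomial, Polynomial.algebraMap_hahnSeries_apply, coe_mul, coe_C, coe_pow,
    coe_X, map_mul, HahnSeries.ofPowerSeries_C, HahnSeries.ofPowerSeries_X_pow, HahnSeries.C_apply,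
    HahnSeries.single_mul_single, zero_add, mul_one]

theorem laurentExpand_algebraMap (n : ℕ+) (A : F[X]) :
    laurentExpand F n (algebraMap F[X] (LaurentSeries F) A) =
      algebraMap F[X] (LaurentSeries F) (expand F n A) := by
  induction A using Polynomial.induction_on' with
  | add A B hA hB => simp only [map_add, hA, hB]
  | monomial m c =>
    rw [expand_monomial, algebraMap_monomial, algebraMap_monomial, laurentExpand_single, mul_comm,
      Nat.cast_mul]

theorem coeff_mul_contract (n : ℕ+) (f : LaurentSeries F) (B : F[X]) (k : ℤ) :
    (f * algebraMap F[X] (LaurentSeries F) (contract n B)).coeff k =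
      (laurentExpand F n f * algebraMap F[X] (LaurentSeries F) B).coeff (((n : ℕ) : ℤ) * k) := by
  have hn : (n : ℕ) ≠ 0 := n.ne_zero
  induction B using Polynomial.induction_on' with
  | add A B hA hB => simp only [contract_add hn, map_add, mul_add, HahnSeries.coeff_add, hA, hB]
  | monomial m c =>
    rw [algebraMap_monomial, HahnSeries.coeff_mul_single]
    by_cases h : (n : ℕ) ∣ m
    · obtain ⟨d, rfl⟩ := h
      have hcontract : contract n (monomial (n * d) c) = monomial d c := by
        ext j
        simp [coeff_contract hn, coeff_monomial, mul_comm j, hn]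
      rw [hcontract, algebraMap_monomial, HahnSeries.coeff_mul_single,
        ← coeff_laurentExpand_mul n f (k - d), mul_sub, Nat.cast_mul]
    · have hcontract : contract n (monomial m c) = 0 := by
        ext j
        rw [coeff_contract hn, coeff_monomial, coeff_zero,
          if_neg (by rintro rfl; exact h (dvd_mul_left _ _))]
      rw [hcontract, map_zero, mul_zero, HahnSeries.coeff_zero,
        coeff_laurentExpand_of_not_dvd, zero_mul]
      rw [dvd_sub_right (dvd_mul_right _ _)]
      exact_mod_cast h

end LaurentExpand

section RationalSeries

open scoped RatFunc

variable (F : Type*) [Field F]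

/-- The subfield `F(x)` of `F((x))`. -/
def rationalSeries : Subfield (LaurentSeries F) :=
  (algebraMap (RatFunc F) (LaurentSeries F)).fieldRange

variable {F}

theorem algebraMap_polynomial_mem_rationalSeries (A : F[X]) :
    algebraMap F[X] (LaurentSeries F) A ∈ rationalSeries F :=
  ⟨algebraMap F[X] (RatFunc F) A, (IsScalarTower.algebraMap_apply F[X] (RatFunc F) _ A).symm⟩

theorem mem_rationalSeries_iff {f : LaurentSeries F} :
    f ∈ rationalSeries F ↔ ∃ A B : F[X], B ≠ 0 ∧
      f = algebraMap F[X] (LaurentSeries F) A / algebraMap F[X] (LaurentSeries F) B := by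
  constructor
  · rintro ⟨g, rfl⟩
    exact ⟨g.num, g.denom, g.denom_ne_zero, by
      rw [← RatFunc.algebraMap_apply_div, RatFunc.num_div_denom]⟩
  · rintro ⟨A, B, -, rfl⟩
    exact div_mem (algebraMap_polynomial_mem_rationalSeries A)
      (algebraMap_polynomial_mem_rationalSeries B)

theorem single_mem_rationalSeries (n : ℤ) (c : F) :
    (HahnSeries.single n c : LaurentSeries F) ∈ rationalSeries F :=
  mem_rationalSeries_iff.mpr ⟨monomial n.toNat c, monomial (-n).toNat 1, by simp, by
    rw [algebraMap_monomial, algebraMap_monomial, HahnSeries.single_div_single, div_one,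
      n.toNat_sub_toNat_neg]⟩

theorem algebraMap_polynomial_ne_zero {A : F[X]} (hA : A ≠ 0) :
    algebraMap F[X] (LaurentSeries F) A ≠ 0 :=
  (map_ne_zero_iff _ (Polynomial.algebraMap_hahnSeries_injective ℤ)).mpr hA

theorem laurentExpand_mem_rationalSeries {n : ℕ+} {f : LaurentSeries F} :
    laurentExpand F n f ∈ rationalSeries F ↔ f ∈ rationalSeries F := by
  simp only [mem_rationalSeries_iff]
  constructor
  · rintro ⟨A, B, hB, h⟩
    rw [eq_div_iff (algebraMap_polynomial_ne_zero hB)] at h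
    obtain ⟨m, hm⟩ := not_forall.mp (mt Polynomial.ext hB)
    -- After multiplication by `X ^ i`, some exponent occurring in `B` is a multiple of `n`.
    obtain ⟨i, hi⟩ : ∃ i, m * (n : ℕ) = m + i :=
      Nat.exists_eq_add_of_le (Nat.le_mul_of_pos_right m n.pos)
    have hB' : contract n (B * X ^ i) ≠ 0 := fun h0 => hm <| by
      rw [← coeff_mul_X_pow B i m, ← hi, ← coeff_contract n.ne_zero, h0, coeff_zero]
    refine ⟨contract n (A * X ^ i), contract n (B * X ^ i), hB',
      (eq_div_iff (algebraMap_polynomial_ne_zero hB')).mpr ?_⟩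
    ext k
    rw [coeff_mul_contract, map_mul, ← mul_assoc, h, ← map_mul]
    have h1 := coeff_mul_contract n 1 (A * X ^ i) k
    rw [one_mul, map_one, one_mul] at h1
    exact h1.symm
  · rintro ⟨A, B, hB, rfl⟩
    exact ⟨_, _, (expand_ne_zero n.pos).mpr hB, by
      rw [map_div₀, laurentExpand_algebraMap, laurentExpand_algebraMap]⟩

theorem ramify_mem_ramRat {q : ℕ+} {f : LaurentSeries F} :
    ramify q f ∈ RamRat F ↔ f ∈ rationalSeries F := by
  have hpoly (n : ℕ+) (A : F[X]) :
      polyRamify n A = ramify n (algebraMap F[X] (LaurentSeries F) A) := rfl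
  constructor
  · rintro ⟨n, A, B, hB, h⟩
    rw [hpoly, hpoly, ← map_div₀, ← ramify_mul_expand q n, ← ramify_mul_expand n q, mul_comm n q]
      at h
    rw [← laurentExpand_mem_rationalSeries (n := n), RingHom.injective _ h,
      laurentExpand_mem_rationalSeries]
    exact mem_rationalSeries_iff.mpr ⟨A, B, hB, rfl⟩
  · intro h
    obtain ⟨A, B, hB, rfl⟩ := mem_rationalSeries_iff.mp h
    exact ⟨q, A, B, hB, by rw [hpoly, hpoly, map_div₀]⟩

end RationalSeries

section LaurentPolynomial

open LaurentPolynomial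

variable {F : Type*} [Field F]

instance : Algebra F[T;T⁻¹] (LaurentSeries F) :=
  (AddMonoidAlgebra.liftNCRingHom HahnSeries.C
    { toFun := fun n : Multiplicative ℤ => HahnSeries.single n.toAdd (1 : F)
      map_one' := rfl
      map_mul' := fun m n => by rw [HahnSeries.single_mul_single, mul_one, toAdd_mul] }
    fun _ _ => Commute.all _ _).toAlgebra

theorem algebraMap_single (n : ℤ) (c : F) :
    algebraMap F[T;T⁻¹] (LaurentSeries F) (.single n c) = HahnSeries.single n c := by
  refine (AddMonoidAlgebra.liftNC_single ..).trans ?_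
  exact (HahnSeries.single_mul_single ..).trans (by rw [zero_add, mul_one, toAdd_ofAdd])

theorem coeff_algebraMap (p : F[T;T⁻¹]) (n : ℤ) :
    (algebraMap F[T;T⁻¹] (LaurentSeries F) p).coeff n = p.coeff n := by
  induction p using AddMonoidAlgebra.induction_linear with
  | zero => simp
  | add p p' hp hp' => simp [hp, hp']
  | single m c =>
    rw [algebraMap_single, AddMonoidAlgebra.coeff_single]
    obtain rfl | hmn := eq_or_ne n m
    · rw [HahnSeries.coeff_single_same, Finsupp.single_eq_same]
    · rw [HahnSeries.coeff_single_of_ne hmn, Finsupp.single_eq_of_ne hmn]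

theorem laurentPolyToSeries_eq_algebraMap (p : F[T;T⁻¹]) :
    laurentPolyToSeries p = algebraMap F[T;T⁻¹] (LaurentSeries F) p := by
  ext n
  rw [coeff_algebraMap, laurentPolyToSeries, HahnSeries.coeff_sum, Finset.sum_eq_single n]
  · exact HahnSeries.coeff_single_same n _
  · exact fun m _ hm => HahnSeries.coeff_single_of_ne hm.symm
  · intro h
    rw [Finsupp.notMem_support_iff.mp h, map_zero, HahnSeries.coeff_zero]

theorem algebraMap_toLaurent (A : F[X]) :
    algebraMap F[T;T⁻¹] (LaurentSeries F) (toLaurent A) = algebraMap F[X] (LaurentSeries F) A := by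
  induction A using Polynomial.induction_on' with
  | add A B hA hB => simp only [map_add, hA, hB]
  | monomial m c =>
    rw [algebraMap_monomial, ← C_mul_X_pow_eq_monomial, toLaurent_C_mul_X_pow,
      ← single_eq_C_mul_T, algebraMap_single]

theorem algebraMap_laurentPolynomial_mem_rationalSeries (p : F[T;T⁻¹]) :
    algebraMap F[T;T⁻¹] (LaurentSeries F) p ∈ rationalSeries F := by
  induction p using AddMonoidAlgebra.induction_linear with
  | zero => rw [map_zero]; exact zero_mem _
  | add p p' hp hp' => rw [map_add]; exact add_mem hp hp'
  | single n c => rw [algebraMap_single]; exact single_mem_rationalSeries n c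

instance : FaithfulSMul F[T;T⁻¹] (LaurentSeries F) :=
  (faithfulSMul_iff_algebraMap_injective _ _).mpr fun p p' h => LaurentPolynomial.ext fun n => by
    rw [← coeff_algebraMap, h, coeff_algebraMap]

instance : IsScalarTower F F[T;T⁻¹] (LaurentSeries F) where
  smul_assoc c p f := by
    have hc : algebraMap F[T;T⁻¹] (LaurentSeries F) (LaurentPolynomial.C c) = HahnSeries.C c :=
      algebraMap_single 0 c
    rw [← HahnSeries.C_mul_eq_smul, LaurentPolynomial.smul_eq_C_mul, mul_smul, ← hc,
      Algebra.smul_def (LaurentPolynomial.C c)]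

instance : IsPrincipalIdealRing F[T;T⁻¹] where
  principal I := by
    obtain ⟨g, hg⟩ := IsPrincipalIdealRing.principal (I.under F[X])
    refine ⟨algebraMap F[X] F[T;T⁻¹] g, ?_⟩
    rw [← IsLocalization.map_under (Submonoid.powers (X : F[X])) F[T;T⁻¹] I, hg]
    exact (Ideal.map_span _ _).trans (by rw [Set.image_singleton])

end LaurentPolynomial

section Echelon

open LaurentPolynomial

variable {F : Type*} [Field F]

/-- The set of the valuations of the nonzero members of `P`. -/
def valuations (P : Submodule F F[T;T⁻¹]) : Set ℤ :=
  {n | ∃ p ∈ P, IsLeast (Function.support p.coeff) n}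

theorem exists_isLeast_support_mem_valuations {P : Submodule F F[T;T⁻¹]} {p : F[T;T⁻¹]}
    (hp : p ∈ P) (hp0 : p ≠ 0) : ∃ n ∈ valuations P, IsLeast (Function.support p.coeff) n := by
  have hne : p.coeff.support.Nonempty := Finsupp.support_nonempty_iff.mpr
    fun h => hp0 (LaurentPolynomial.ext fun n => by rw [h, AddMonoidAlgebra.coeff_zero])
  have hleast : IsLeast (Function.support p.coeff) (p.coeff.support.min' hne) := by
    rw [Finsupp.fun_support_eq]
    exact p.coeff.support.isLeast_min' hne
  exact ⟨_, ⟨p, hp, hleast⟩, hleast⟩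

/-- The linear map that sends a Laurent polynomial to its coefficients at the exponents in `S`. -/
def coeffsAt (F : Type*) [Field F] (S : Finset ℤ) : F[T;T⁻¹] →ₗ[F] S → F where
  toFun p n := p.coeff n
  map_add' _ _ := rfl
  map_smul' _ _ := rfl

theorem coeffsAt_valuations_bijective {P : Submodule F F[T;T⁻¹]} {S : Finset ℤ}
    (hS : (S : Set ℤ) = valuations P) :
    Function.Bijective ((coeffsAt F S).comp P.subtype) := by
  constructor
  · refine (injective_iff_map_eq_zero _).mpr fun p hp => ?_
    by_contra hp0
    obtain ⟨n, hn, hpn⟩ := exists_isLeast_support_mem_valuations p.2 fun h => hp0 (Subtype.ext h)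
    exact hpn.1 (congrFun hp ⟨n, by rwa [← hS] at hn⟩)
  · have hmem (n : S) : (n : ℤ) ∈ valuations P := hS ▸ Finset.mem_coe.mpr n.2
    choose f hfP hf using hmem
    let A : Matrix S S F := Matrix.of fun n => coeffsAt F S (f n)
    have hA : A.det ≠ 0 := by
      have htriangular : A.IsUpperTriangular :=
        fun n m hmn => by_contra fun h => hmn.not_ge ((hf n).2 h)
      rw [Matrix.det_of_isUpperTriangular htriangular]
      exact Finset.prod_ne_zero_iff.mpr fun n _ => (hf n).1
    intro c
    obtain ⟨w, hw⟩ := Matrix.vecMul_surjective_iff_isUnit.mpr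
      ((Matrix.isUnit_iff_isUnit_det A).mpr hA.isUnit) c
    refine ⟨∑ n, w n • ⟨f n, hfP n⟩, ?_⟩
    rw [← hw, map_sum]
    dsimp only
    rw [Matrix.vecMul_eq_sum]
    exact Finset.sum_congr rfl fun n _ => map_smul ((coeffsAt F S).comp P.subtype) _ _

theorem exists_isReducedEchelon {P : Submodule F F[T;T⁻¹]} (hP : (valuations P).Finite) :
    ∃ (s : ℕ) (p : Fin s → F[T;T⁻¹]),
      Submodule.span F (Set.range p) = P ∧ IsReducedEchelon p := by
  let S := hP.toFinset
  let v : Fin S.card ≃o S := S.orderIsoOfFin rfl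
  let e : P ≃ₗ[F] S → F :=
    LinearEquiv.ofBijective _ (coeffsAt_valuations_bijective hP.coe_toFinset)
  let B : Module.Basis (Fin S.card) F P :=
    (Module.Basis.ofEquivFun e).reindex v.symm.toEquiv
  have hB (i j) : (B i : F[T;T⁻¹]).coeff (v j) = if i = j then 1 else 0 := by
    have h : e (B i) = Pi.single (v i) 1 := by simp [B]
    refine (congrFun h (v j)).trans ?_
    simp only [Pi.single_apply, v.injective.eq_iff, eq_comm]
  refine ⟨S.card, fun j => B j, ?_, fun j => v j, fun i j hij => v.strictMono hij, ?_, hB⟩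
  · have := congrArg (Submodule.map P.subtype) B.span_eq
    rwa [Submodule.map_span, ← Set.range_comp, Submodule.map_top, Submodule.range_subtype] at this
  · intro j n hn
    obtain ⟨m, hm, hleast⟩ :=
      exists_isLeast_support_mem_valuations (B j).2 (Subtype.coe_ne_coe.mpr (B.ne_zero j))
    obtain ⟨i, hi⟩ := v.surjective ⟨m, hP.mem_toFinset.mpr hm⟩
    obtain rfl : m = v i := by rw [hi]
    have hij : j = i := by
      by_contra h
      exact hleast.1 (by rw [hB, if_neg h])
    exact by_contra fun h => (hleast.2 h).not_gt (hij ▸ hn)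

theorem eq_sum_of_mem_span {s : ℕ} {p : Fin s → F[T;T⁻¹]} {v : Fin s → ℤ}
    (h : ∀ i j, (p i).coeff (v j) = if i = j then 1 else 0) {x : F[T;T⁻¹]}
    (hx : x ∈ Submodule.span F (Set.range p)) : x = ∑ j, x.coeff (v j) • p j := by
  obtain ⟨c, rfl⟩ := (Submodule.mem_span_range_iff_exists_fun F).1 hx
  refine Finset.sum_congr rfl fun j _ => ?_
  simp [AddMonoidAlgebra.coeff_sum, h]

theorem IsReducedEchelon.linearIndependent {s : ℕ} {p : Fin s → F[T;T⁻¹]}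
    (hp : IsReducedEchelon p) : LinearIndependent F p := by
  obtain ⟨v, -, -, h⟩ := hp
  refine Fintype.linearIndependent_iff.mpr fun c hc i => ?_
  simpa [AddMonoidAlgebra.coeff_sum, h] using congrArg (fun x => x.coeff (v i)) hc

theorem valuations_span_range {s : ℕ} {p : Fin s → F[T;T⁻¹]} {v : Fin s → ℤ}
    (hlow : ∀ j, ∀ n < v j, (p j).coeff n = 0)
    (h : ∀ i j, (p i).coeff (v j) = if i = j then 1 else 0) :
    valuations (Submodule.span F (Set.range p)) = Set.range v := by
  have hleast (j) : IsLeast (Function.support (p j).coeff) (v j) :=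
    ⟨by simp [h], fun n hn => not_lt.mp fun hlt => hn (hlow j n hlt)⟩
  apply Set.Subset.antisymm
  · rintro n ⟨x, hx, hxn⟩
    have hsum : x.coeff n = ∑ j, x.coeff (v j) * (p j).coeff n := by
      conv_lhs => rw [eq_sum_of_mem_span h hx]
      simp [AddMonoidAlgebra.coeff_sum]
    obtain ⟨j, -, hj⟩ := Finset.exists_ne_zero_of_sum_ne_zero
      (hsum.symm.trans_ne (Function.mem_support.mp hxn.1))
    exact ⟨j, le_antisymm ((hleast j).2 (right_ne_zero_of_mul hj))
      (hxn.2 (left_ne_zero_of_mul hj))⟩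
  · rintro _ ⟨j, rfl⟩
    exact ⟨p j, Submodule.subset_span ⟨j, rfl⟩, hleast j⟩

theorem IsReducedEchelon.eq_of_span_eq {s s' : ℕ} {p : Fin s → F[T;T⁻¹]}
    {p' : Fin s' → F[T;T⁻¹]} (hp : IsReducedEchelon p) (hp' : IsReducedEchelon p')
    (hspan : Submodule.span F (Set.range p) = Submodule.span F (Set.range p')) :
    ∃ h : s = s', p = p' ∘ Fin.cast h := by
  obtain ⟨v, hv, hlow, h⟩ := hp
  obtain ⟨v', hv', hlow', h'⟩ := hp'
  have hrange : Set.range v = Set.range v' := by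
    rw [← valuations_span_range hlow h, ← valuations_span_range hlow' h', hspan]
  obtain rfl : s = s' := by
    have hcard := Nat.card_range_of_injective hv.injective
    rw [hrange, Nat.card_range_of_injective hv'.injective, Nat.card_fin, Nat.card_fin] at hcard
    exact hcard.symm
  obtain rfl : v = v' := (hv.range_inj hv').1 hrange
  refine ⟨rfl, funext fun i => ?_⟩
  have hmem : p' i ∈ Submodule.span F (Set.range p) := hspan ▸ Submodule.subset_span ⟨i, rfl⟩
  have hsum := eq_sum_of_mem_span h hmem
  simp only [h', ite_smul, one_smul, zero_smul, Finset.sum_ite_eq, Finset.mem_univ, if_true] at hsum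
  exact hsum.symm

end Echelon

section PrincipalUnits

variable {F : Type*} [Field F]

theorem laurentExpand_ofPowerSeries (b : ℕ+) (f : PowerSeries F) :
    laurentExpand F b (HahnSeries.ofPowerSeries ℤ F f) =
      HahnSeries.ofPowerSeries ℤ F (PowerSeries.expand b b.ne_zero f) := by
  ext k
  by_cases hk : ((b : ℕ) : ℤ) ∣ k
  · obtain ⟨m, rfl⟩ := hk
    rw [coeff_laurentExpand_mul, PowerSeries.coeff_coe, PowerSeries.coeff_coe, Int.natAbs_mul,
      Int.natAbs_natCast, PowerSeries.coeff_expand_mul]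
    simp only [mul_neg_iff, Int.natCast_pos, b.pos, true_and, Int.natCast_nonneg, not_lt_of_ge,
      false_and, or_false]
  · rw [coeff_laurentExpand_of_not_dvd b _ hk, PowerSeries.coeff_coe,
      PowerSeries.coeff_expand_of_not_dvd _ _ _ fun h => hk (Int.natCast_dvd.mpr h), ite_self]

/-- Principal units of `F((x))`: the power series with constant term `1`. -/
def IsPrincipalUnit (φ : LaurentSeries F) : Prop :=
  ∃ f : PowerSeries F, PowerSeries.constantCoeff f = 1 ∧ HahnSeries.ofPowerSeries ℤ F f = φ

theorem IsPrincipalUnit.ne_zero {φ : LaurentSeries F} (h : IsPrincipalUnit φ) : φ ≠ 0 := by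
  obtain ⟨f, hf, rfl⟩ := h
  rw [Ne, map_eq_zero_iff _ HahnSeries.ofPowerSeries_injective]
  rintro rfl
  exact zero_ne_one hf

theorem IsPrincipalUnit.div {φ ψ : LaurentSeries F} (h : IsPrincipalUnit φ)
    (h' : IsPrincipalUnit ψ) : IsPrincipalUnit (φ / ψ) := by
  have hψ := h'.ne_zero
  obtain ⟨f, hf, rfl⟩ := h
  obtain ⟨f', hf', rfl⟩ := h'
  refine ⟨f * f'⁻¹, by rw [map_mul, PowerSeries.constantCoeff_inv, hf, hf', inv_one, mul_one], ?_⟩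
  rw [eq_div_iff hψ, ← map_mul, mul_assoc, PowerSeries.inv_mul_cancel, mul_one]
  rw [hf']
  exact one_ne_zero

theorem exists_isPrincipalUnit_single_mul {f : LaurentSeries F} (hf : f ≠ 0) :
    ∃ (n : ℤ) (c : F), c ≠ 0 ∧ IsPrincipalUnit (HahnSeries.single n c * f) := by
  have hc : f.leadingCoeff ≠ 0 := HahnSeries.leadingCoeff_ne_zero.mpr hf
  refine ⟨-f.order, f.leadingCoeff⁻¹, inv_ne_zero hc,
    PowerSeries.C f.leadingCoeff⁻¹ * f.powerSeriesPart, ?_, ?_⟩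
  · rw [map_mul, PowerSeries.constantCoeff_C, ← PowerSeries.coeff_zero_eq_constantCoeff_apply,
      LaurentSeries.powerSeriesPart_coeff, Nat.cast_zero, add_zero, ← HahnSeries.leadingCoeff_eq,
      inv_mul_cancel₀ hc]
  · rw [map_mul, LaurentSeries.ofPowerSeries_powerSeriesPart, HahnSeries.ofPowerSeries_C,
      HahnSeries.C_apply, ← mul_assoc, HahnSeries.single_mul_single, zero_add, mul_one]

theorem IsPrincipalUnit.eq_one_of_laurentExpand_eq {b : ℕ+} (hb : 2 ≤ (b : ℕ))
    {χ : LaurentSeries F} (h : IsPrincipalUnit χ) (hχ : laurentExpand F b χ = χ) : χ = 1 := by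
  obtain ⟨f, hf, rfl⟩ := h
  rw [laurentExpand_ofPowerSeries] at hχ
  have hfix := HahnSeries.ofPowerSeries_injective hχ
  have hcoeff (n : ℕ) : n ≠ 0 → PowerSeries.coeff n f = 0 := by
    induction n using Nat.strong_induction_on with
    | _ n ih =>
    intro hn
    rw [← hfix, PowerSeries.coeff_expand]
    split_ifs with hdvd
    · exact ih _ (Nat.div_lt_self (Nat.pos_of_ne_zero hn) hb)
        (Nat.div_ne_zero_iff_of_dvd hdvd |>.mpr ⟨hn, b.ne_zero⟩)
    · rfl
  rw [map_eq_one_iff _ HahnSeries.ofPowerSeries_injective]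
  ext n
  obtain rfl | hn := eq_or_ne n 0
  · simpa using hf
  · rw [hcoeff n hn, PowerSeries.coeff_one, if_neg hn]

theorem IsPrincipalUnit.eq_of_laurentExpand_div_eq {b : ℕ+} (hb : 2 ≤ (b : ℕ))
    {φ ψ : LaurentSeries F} (hφ : IsPrincipalUnit φ) (hψ : IsPrincipalUnit ψ)
    (h : laurentExpand F b φ / φ = laurentExpand F b ψ / ψ) : φ = ψ := by
  have hψ' : laurentExpand F b ψ ≠ 0 := (_root_.map_ne_zero _).mpr hψ.ne_zero
  rw [← div_eq_one_iff_eq hψ.ne_zero]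
  refine (hφ.div hψ).eq_one_of_laurentExpand_eq hb ?_
  rw [map_div₀, div_eq_div_iff hψ' hψ.ne_zero]
  rw [div_eq_div_iff hφ.ne_zero hψ.ne_zero] at h
  rw [h, mul_comm]

end PrincipalUnits

section InfiniteProduct

open scoped RatFunc

variable {F : Type*} [Field F]

theorem eval_zero_eq_one_iff {g : RatFunc F} : RatFunc.eval (RingHom.id F) 0 g = 1 ↔
    g.num.coeff 0 = g.denom.coeff 0 := by
  rw [RatFunc.eval, Polynomial.eval₂_id, Polynomial.eval₂_id, ← coeff_zero_eq_eval_zero,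
    ← coeff_zero_eq_eval_zero]
  refine ⟨eq_of_div_eq_one, fun h => ?_⟩
  rw [h, div_self]
  intro h0
  obtain ⟨u, w, huw⟩ := g.isCoprime_num_denom
  simpa [mul_coeff_zero, h, h0] using congrArg (fun P => P.coeff 0) huw

theorem num_coeff_zero_ne_zero {g : RatFunc F} (hg : RatFunc.eval (RingHom.id F) 0 g = 1) :
    g.num.coeff 0 ≠ 0 := fun h0 => by
  rw [RatFunc.eval, Polynomial.eval₂_id, ← coeff_zero_eq_eval_zero, h0, zero_div] at hg
  exact zero_ne_one hg

theorem coe_expand (b : ℕ+) (A : F[X]) :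
    ((expand F b A : F[X]) : PowerSeries F) = PowerSeries.expand b b.ne_zero A := by
  ext n
  rw [Polynomial.coeff_coe, coeff_expand b.pos, PowerSeries.coeff_expand, Polynomial.coeff_coe]

theorem powerSeries_expand_inv (b : ℕ+) (f : PowerSeries F) :
    PowerSeries.expand b b.ne_zero f⁻¹ = (PowerSeries.expand b b.ne_zero f)⁻¹ := by
  by_cases hf : PowerSeries.constantCoeff f = 0
  · rw [PowerSeries.inv_eq_zero.mpr hf, map_zero, eq_comm, PowerSeries.inv_eq_zero,
      PowerSeries.constantCoeff_expand, hf]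
  · rw [PowerSeries.eq_inv_iff_mul_eq_one (by rwa [PowerSeries.constantCoeff_expand]), ← map_mul,
      PowerSeries.inv_mul_cancel f hf, map_one]

theorem invFactor_succ (b : ℕ+) (g : RatFunc F) (k : ℕ) :
    invFactor b g (k + 1) = PowerSeries.expand b b.ne_zero (invFactor b g k) := by
  rw [invFactor, invFactor, map_mul, powerSeries_expand_inv, ← coe_expand, ← coe_expand,
    ← Polynomial.expand_mul, ← Polynomial.expand_mul, pow_succ']

theorem num_mul_invFactor_zero (b : ℕ+) {g : RatFunc F}
    (hg : RatFunc.eval (RingHom.id F) 0 g = 1) :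
    (g.num : PowerSeries F) * invFactor b g 0 = g.denom := by
  rw [invFactor, pow_zero, expand_one, expand_one, mul_left_comm, PowerSeries.mul_inv_cancel,
    mul_one]
  rw [constantCoeff_coe]
  exact num_coeff_zero_ne_zero hg

theorem num_mul_prod_invFactor (b : ℕ+) {g : RatFunc F}
    (hg : RatFunc.eval (RingHom.id F) 0 g = 1) (m : ℕ) :
    (g.num : PowerSeries F) * ∏ k ∈ Finset.range (m + 1), invFactor b g k =
      (g.denom : PowerSeries F) *
        PowerSeries.expand b b.ne_zero (∏ k ∈ Finset.range m, invFactor b g k) := by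
  rw [Finset.prod_range_succ', mul_left_comm, num_mul_invFactor_zero b hg, mul_comm, map_prod]
  simp only [invFactor_succ]

theorem X_pow_dvd_infProd_sub_prod {b : ℕ+} (hb : 2 ≤ (b : ℕ)) {g : RatFunc F}
    (hg : RatFunc.eval (RingHom.id F) 0 g = 1) (m : ℕ) :
    PowerSeries.X ^ m ∣ infProd b g - ∏ k ∈ Finset.range m, invFactor b g k :=
  PowerSeries.X_pow_dvd_iff.mpr fun n hn => by
    rw [map_sub, coeff_prod_invFactor b hb g hg n m hn, sub_self]

theorem num_mul_infProd {b : ℕ+} (hb : 2 ≤ (b : ℕ)) {g : RatFunc F}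
    (hg : RatFunc.eval (RingHom.id F) 0 g = 1) :
    (g.num : PowerSeries F) * infProd b g =
      (g.denom : PowerSeries F) * PowerSeries.expand b b.ne_zero (infProd b g) := by
  have hdvd (m : ℕ) : PowerSeries.X ^ m ∣ (g.num : PowerSeries F) * infProd b g -
      (g.denom : PowerSeries F) * PowerSeries.expand b b.ne_zero (infProd b g) := by
    have hleft : PowerSeries.X ^ m ∣ infProd b g - ∏ k ∈ Finset.range (m + 1), invFactor b g k :=
      (pow_dvd_pow _ m.le_succ).trans (X_pow_dvd_infProd_sub_prod hb hg (m + 1))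
    have hright := map_dvd (PowerSeries.expand (b : ℕ) b.ne_zero)
      (X_pow_dvd_infProd_sub_prod hb hg m)
    rw [map_pow, PowerSeries.expand_X, map_sub] at hright
    convert (hleft.mul_left (g.num : PowerSeries F)).sub
      (((pow_dvd_pow_of_dvd (dvd_pow_self _ b.ne_zero) m).trans hright).mul_left
        (g.denom : PowerSeries F)) using 1
    rw [mul_sub, mul_sub, num_mul_prod_invFactor b hg]
    ring
  ext n
  rw [← sub_eq_zero, ← map_sub]
  exact PowerSeries.X_pow_dvd_iff.mp (hdvd (n + 1)) n n.lt_succ_self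

/-- The infinite product `∏ 1 / g(x^(b^k))` over `k ≥ 0` as a Laurent series. -/
def infProdLaurent (b : ℕ+) (g : RatFunc F) : LaurentSeries F :=
  HahnSeries.ofPowerSeries ℤ F (infProd b g)

theorem isPrincipalUnit_infProdLaurent (b : ℕ+) {g : RatFunc F}
    (hg : RatFunc.eval (RingHom.id F) 0 g = 1) : IsPrincipalUnit (infProdLaurent b g) := by
  refine ⟨_, ?_, rfl⟩
  rw [← PowerSeries.coeff_zero_eq_constantCoeff_apply, infProd, PowerSeries.coeff_mk, zero_add,
    Finset.prod_range_one, PowerSeries.coeff_zero_eq_constantCoeff_apply]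
  have h := congrArg PowerSeries.constantCoeff (num_mul_invFactor_zero b hg)
  rw [map_mul, constantCoeff_coe, constantCoeff_coe, ← eval_zero_eq_one_iff.mp hg] at h
  exact mul_eq_left₀ (num_coeff_zero_ne_zero hg) |>.mp h

theorem algebraMap_ratFunc_eq_div (g : RatFunc F) : algebraMap (RatFunc F) (LaurentSeries F) g =
    HahnSeries.ofPowerSeries ℤ F g.num / HahnSeries.ofPowerSeries ℤ F g.denom := by
  conv_lhs => rw [← RatFunc.num_div_denom g, RatFunc.algebraMap_apply_div]
  rfl

theorem algebraMap_eq_laurentExpand_div_iff {b : ℕ+} {g : RatFunc F} {f : PowerSeries F}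
    (hf : f ≠ 0) : algebraMap (RatFunc F) (LaurentSeries F) g =
      laurentExpand F b (HahnSeries.ofPowerSeries ℤ F f) / HahnSeries.ofPowerSeries ℤ F f ↔
        (g.num : PowerSeries F) * f = g.denom * PowerSeries.expand b b.ne_zero f := by
  have hf' : HahnSeries.ofPowerSeries ℤ F f ≠ 0 :=
    (map_ne_zero_iff _ HahnSeries.ofPowerSeries_injective).mpr hf
  have hdenom : HahnSeries.ofPowerSeries ℤ F g.denom ≠ 0 :=
    algebraMap_polynomial_ne_zero g.denom_ne_zero
  rw [algebraMap_ratFunc_eq_div, div_eq_div_iff hdenom hf', laurentExpand_ofPowerSeries, ← map_mul,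
    ← map_mul, HahnSeries.ofPowerSeries_injective.eq_iff, mul_comm (PowerSeries.expand _ _ f)]

theorem laurentExpand_infProdLaurent_div {b : ℕ+} (hb : 2 ≤ (b : ℕ)) {g : RatFunc F}
    (hg : RatFunc.eval (RingHom.id F) 0 g = 1) :
    laurentExpand F b (infProdLaurent b g) / infProdLaurent b g =
      algebraMap (RatFunc F) (LaurentSeries F) g := by
  refine ((algebraMap_eq_laurentExpand_div_iff fun h0 => ?_).mpr (num_mul_infProd hb hg)).symm
  exact (isPrincipalUnit_infProdLaurent b hg).ne_zero (by rw [infProdLaurent, h0, map_zero])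

theorem IsPrincipalUnit.exists_eq_infProdLaurent {b : ℕ+} (hb : 2 ≤ (b : ℕ)) {φ : LaurentSeries F}
    (hφ : IsPrincipalUnit φ) (hr : laurentExpand F b φ / φ ∈ rationalSeries F) :
    ∃ g : RatFunc F, RatFunc.eval (RingHom.id F) 0 g = 1 ∧ φ = infProdLaurent b g := by
  obtain ⟨g, hg⟩ := hr
  have heval : RatFunc.eval (RingHom.id F) 0 g = 1 := by
    obtain ⟨f, hf, rfl⟩ := hφ
    have hf0 : f ≠ 0 := by rintro rfl; exact zero_ne_one hf
    have h := congrArg PowerSeries.constantCoeff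
      ((algebraMap_eq_laurentExpand_div_iff hf0).mp hg)
    rw [map_mul, map_mul, PowerSeries.constantCoeff_expand, hf, mul_one, mul_one,
      constantCoeff_coe, constantCoeff_coe] at h
    exact eval_zero_eq_one_iff.mpr h
  exact ⟨g, heval, hφ.eq_of_laurentExpand_div_eq hb (isPrincipalUnit_infProdLaurent b heval)
    (hg.symm.trans (laurentExpand_infProdLaurent_div hb heval).symm)⟩

theorem infProdLaurent_injOn {b : ℕ+} (hb : 2 ≤ (b : ℕ)) :
    Set.InjOn (infProdLaurent (F := F) b) {g | RatFunc.eval (RingHom.id F) 0 g = 1} :=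
  fun g hg g' hg' h => (algebraMap (RatFunc F) (LaurentSeries F)).injective <| by
    rw [← laurentExpand_infProdLaurent_div hb hg, h, laurentExpand_infProdLaurent_div hb hg']

end InfiniteProduct

section CyclicModules

open LaurentPolynomial

theorem isPrincipal_of_fg_of_not_linearIndependent {R M : Type*} [CommRing R] [IsDomain R]
    [IsPrincipalIdealRing R] [AddCommGroup M] [Module R M] [Module.IsTorsionFree R M]
    {N : Submodule R M} (hN : N.FG) (h : ∀ x ∈ N, ∀ y ∈ N, ¬ LinearIndependent R ![x, y]) :
    N.IsPrincipal := by
  have : Module.Finite R N := Module.Finite.iff_fg.mpr hN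
  have : Module.Free R N := Module.free_of_finite_type_torsion_free'
  rw [← Submodule.rank_le_one_iff_isPrincipal, ← Nat.cast_one]
  refine rank_le fun s hs => Finset.card_le_one.mpr fun x hx y hy => by_contra fun hxy => ?_
  have hinj : Function.Injective ![(⟨x, hx⟩ : s), ⟨y, hy⟩] := by
    simpa [Function.Injective, Fin.forall_fin_two, eq_comm] using hxy
  have hpair : (N.subtype ∘ fun i : s => (i : N)) ∘ ![⟨x, hx⟩, ⟨y, hy⟩] = ![(x : M), y] := by
    ext i
    fin_cases i <;> rfl
  exact h x x.2 y y.2 (hpair ▸ (hs.map' N.subtype N.ker_subtype).comp _ hinj)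

variable {F : Type*} [Field F]

theorem not_linearIndependent_pair_of_div_mem_rationalSeries {f₀ f f' : LaurentSeries F}
    (hf : f / f₀ ∈ rationalSeries F) (hf' : f' / f₀ ∈ rationalSeries F) (hf₀ : f₀ ≠ 0) :
    ¬ LinearIndependent F[T;T⁻¹] ![f, f'] := by
  intro hli
  have hf0 : f ≠ 0 := hli.ne_zero 0
  obtain ⟨A, B, hB, hAB⟩ := mem_rationalSeries_iff.mp (div_mem hf' hf)
  rw [div_div_div_cancel_right₀ hf₀,
    div_eq_div_iff hf0 (algebraMap_polynomial_ne_zero hB)] at hAB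
  have hcoeff := LinearIndependent.pair_iff.mp hli (toLaurent A) (-toLaurent B) (by
    rw [neg_smul, Algebra.smul_def, Algebra.smul_def, algebraMap_toLaurent, algebraMap_toLaurent,
      ← hAB, mul_comm, add_neg_cancel])
  exact hB (Polynomial.toLaurent_injective (by simpa using hcoeff.2))

theorem div_mem_rationalSeries_of_mem_span {S : Set (LaurentSeries F)} {f₀ f : LaurentSeries F}
    (hS : ∀ v ∈ S, v / f₀ ∈ rationalSeries F) (hf : f ∈ Submodule.span F[T;T⁻¹] S) :
    f / f₀ ∈ rationalSeries F := by
  induction hf using Submodule.span_induction with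
  | mem v hv => exact hS v hv
  | zero => rw [zero_div]; exact zero_mem _
  | add v w _ _ hv hw => rw [add_div]; exact add_mem hv hw
  | smul p v _ hv =>
    rw [Algebra.smul_def, mul_div_assoc]
    exact mul_mem (algebraMap_laurentPolynomial_mem_rationalSeries p) hv

theorem isPrincipal_span_of_div_mem_rationalSeries (V : Submodule F (LaurentSeries F))
    [FiniteDimensional F V] {f₀ : LaurentSeries F} (hf₀ : f₀ ≠ 0)
    (hV : ∀ v ∈ V, v / f₀ ∈ rationalSeries F) :
    (Submodule.span F[T;T⁻¹] (V : Set (LaurentSeries F))).IsPrincipal := by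
  refine isPrincipal_of_fg_of_not_linearIndependent ?_ fun x hx y hy =>
    not_linearIndependent_pair_of_div_mem_rationalSeries
      (div_mem_rationalSeries_of_mem_span hV hx) (div_mem_rationalSeries_of_mem_span hV hy) hf₀
  obtain ⟨S, hS⟩ := Module.Finite.iff_fg.mp ‹FiniteDimensional F V›
  exact ⟨S, by rw [← hS, Submodule.span_span_of_tower]⟩

theorem exists_isPrincipalUnit_eq_span_singleton {N : Submodule F[T;T⁻¹] (LaurentSeries F)}
    (hN : N.IsPrincipal) (hN0 : N ≠ ⊥) : ∃ φ, IsPrincipalUnit φ ∧ N = F[T;T⁻¹] ∙ φ := by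
  obtain ⟨f, rfl⟩ := hN
  obtain ⟨n, c, hc, hφ⟩ :=
    exists_isPrincipalUnit_single_mul (Submodule.span_singleton_eq_bot.not.mp hN0)
  have hu : IsUnit (LaurentPolynomial.C c * T n : F[T;T⁻¹]) :=
    (hc.isUnit.map LaurentPolynomial.C).mul (isUnit_T n)
  refine ⟨_, hφ, ?_⟩
  rw [← algebraMap_single, ← Algebra.smul_def, LaurentPolynomial.single_eq_C_mul_T,
    Submodule.span_singleton_smul_eq hu]

theorem exists_eq_single_of_isUnit {p : F[T;T⁻¹]} (hp : IsUnit p) :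
    ∃ (n : ℤ) (c : F), p = .single n c := by
  obtain ⟨p', hp'⟩ := hp.exists_right_inv
  obtain ⟨n, A, hA⟩ := p.exists_T_pow
  obtain ⟨m, B, hB⟩ := p'.exists_T_pow
  have hAB : A * B = X ^ (n + m) := by
    apply Polynomial.toLaurent_injective
    rw [map_mul, hA, hB, mul_mul_mul_comm, hp', one_mul, ← T_add, Polynomial.toLaurent_X_pow,
      Nat.cast_add]
  obtain ⟨i, -, u, hu⟩ := (dvd_prime_pow Polynomial.prime_X _).mp (Dvd.intro _ hAB)
  obtain ⟨c, -, hcu⟩ := Polynomial.isUnit_iff.mp u⁻¹.isUnit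
  have hAi : A = Polynomial.C c * X ^ i := by rw [← hu, hcu, mul_comm, u.mul_inv_cancel_right]
  refine ⟨i - n, c, ?_⟩
  rw [← (isUnit_T (R := F) n).mul_left_inj, ← hA, hAi, map_mul, Polynomial.toLaurent_C,
    Polynomial.toLaurent_X_pow, LaurentPolynomial.single_eq_C_mul_T, mul_T_assoc, sub_add_cancel]

theorem IsPrincipalUnit.single_eq_one {n : ℤ} {c : F}
    (h : IsPrincipalUnit (HahnSeries.single n c)) :
    (HahnSeries.single n c : LaurentSeries F) = 1 := by
  obtain ⟨f, hf, hfc⟩ := h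
  have hcoeff : (HahnSeries.single n c : LaurentSeries F).coeff 0 = 1 := by
    rw [← hfc, PowerSeries.coeff_coe]
    simpa using hf
  obtain rfl : n = 0 := by
    by_contra hn
    rw [HahnSeries.coeff_single_of_ne (Ne.symm hn)] at hcoeff
    exact zero_ne_one hcoeff
  rw [HahnSeries.coeff_single_same] at hcoeff
  rw [hcoeff, HahnSeries.single_zero_one]

theorem IsPrincipalUnit.eq_of_span_singleton_eq {φ ψ : LaurentSeries F} (hφ : IsPrincipalUnit φ)
    (hψ : IsPrincipalUnit ψ) (h : (F[T;T⁻¹] ∙ φ) = F[T;T⁻¹] ∙ ψ) : φ = ψ := by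
  obtain ⟨u, rfl⟩ := Submodule.span_singleton_eq_span_singleton.mp h
  obtain ⟨n, c, hu⟩ := exists_eq_single_of_isUnit u.isUnit
  have hquot := hψ.div hφ
  rw [Units.smul_def, hu, Algebra.smul_def, algebraMap_single,
    mul_div_cancel_right₀ _ hφ.ne_zero] at hquot
  rw [Units.smul_def, hu, Algebra.smul_def, algebraMap_single, hquot.single_eq_one, one_mul]

theorem isCoprimeFamily_iff_span_range_eq_top {s : ℕ} {p : Fin s → F[T;T⁻¹]} :
    IsCoprimeFamily p ↔ Ideal.span (Set.range p) = ⊤ := by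
  obtain ⟨d, hd⟩ := IsPrincipalIdealRing.principal (Ideal.span (Set.range p))
  have hdvd (e : F[T;T⁻¹]) : (∀ j, e ∣ p j) ↔ e ∣ d := by
    rw [← Ideal.span_singleton_le_span_singleton, Ideal.span, ← hd, Submodule.span_le,
      Set.range_subset_iff]
    simp only [SetLike.mem_coe, Ideal.mem_span_singleton]
  rw [IsCoprimeFamily, hd]
  simp only [hdvd]
  exact ⟨fun h => Ideal.span_singleton_eq_top.mpr (h d dvd_rfl),
    fun h e he => isUnit_of_dvd_unit he (Ideal.span_singleton_eq_top.mp h)⟩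

theorem isCoprimeFamily_iff_span_range_smul_eq {s : ℕ} {p : Fin s → F[T;T⁻¹]}
    {φ : LaurentSeries F} (hφ : φ ≠ 0) :
    IsCoprimeFamily p ↔
      Submodule.span F[T;T⁻¹] (Set.range fun j => p j • φ) = F[T;T⁻¹] ∙ φ := by
  have hinj : Function.Injective (LinearMap.toSpanSingleton F[T;T⁻¹] (LaurentSeries F) φ) :=
    smul_left_injective _ hφ
  rw [isCoprimeFamily_iff_span_range_eq_top, LinearMap.span_singleton_eq_range,
    LinearMap.range_eq_map, ← (Submodule.map_injective_of_injective hinj).eq_iff, Ideal.span,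
    Submodule.map_span, ← Set.range_comp]
  rfl

end CyclicModules

section NormalForm

open LaurentPolynomial

variable {F : Type*} [Field F]

theorem finiteDimensional_of_finite_order_image {V : Submodule F (LaurentSeries F)}
    (hV : (HahnSeries.order '' {f | f ∈ V ∧ f ≠ 0}).Finite) : FiniteDimensional F V := by
  have := hV.to_subtype
  let coeffAtOrders : V →ₗ[F] (HahnSeries.order '' {f | f ∈ V ∧ f ≠ 0} → F) :=
    { toFun := fun f n => (f : LaurentSeries F).coeff n
      map_add' := fun _ _ => rfl
      map_smul' := fun _ _ => rfl }
  refine Module.Finite.of_injective coeffAtOrders ?_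
  rw [← LinearMap.ker_eq_bot, LinearMap.ker_eq_bot']
  refine fun f hf => by_contra fun hf0 => ?_
  have hf0' : (f : LaurentSeries F) ≠ 0 := fun h => hf0 (Subtype.ext h)
  exact hf0' (HahnSeries.coeff_order_eq_zero.mp (congrFun hf ⟨_, f, ⟨f.2, hf0'⟩, rfl⟩))

theorem IsPrincipalUnit.order_eq_zero {φ : LaurentSeries F} (hφ : IsPrincipalUnit φ) :
    φ.order = 0 := by
  have hφ0 := hφ.ne_zero
  obtain ⟨f, hf, rfl⟩ := hφ
  refine le_antisymm (HahnSeries.order_le_of_coeff_ne_zero ?_) (le_of_not_gt fun h => hφ0 ?_)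
  · rw [PowerSeries.coeff_coe, if_neg (lt_irrefl 0), Int.natAbs_zero,
      PowerSeries.coeff_zero_eq_constantCoeff_apply, hf]
    exact one_ne_zero
  · rw [← HahnSeries.coeff_order_eq_zero, PowerSeries.coeff_coe, if_pos h]

theorem order_algebraMap_eq_of_isLeast {p : F[T;T⁻¹]} {n : ℤ}
    (h : IsLeast (Function.support p.coeff) n) :
    (algebraMap F[T;T⁻¹] (LaurentSeries F) p).order = n := by
  have hn : (algebraMap F[T;T⁻¹] (LaurentSeries F) p).coeff n ≠ 0 := by
    rw [coeff_algebraMap]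
    exact h.1
  refine le_antisymm (HahnSeries.order_le_of_coeff_ne_zero hn) (h.2 ?_)
  rw [Function.mem_support, ← coeff_algebraMap, Ne, HahnSeries.coeff_order_eq_zero]
  exact HahnSeries.ne_zero_of_coeff_ne_zero hn

theorem laurentExpand_div_mem_rationalSeries {b : ℕ+} {f₀ f : LaurentSeries F} (hf₀ : f₀ ≠ 0)
    (hf₀b : laurentExpand F b f₀ / f₀ ∈ rationalSeries F) (hf : f / f₀ ∈ rationalSeries F) :
    laurentExpand F b f / f ∈ rationalSeries F := by
  have hf₀' : laurentExpand F b f₀ ≠ 0 := (_root_.map_ne_zero _).mpr hf₀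
  have heq : laurentExpand F b f / f =
      laurentExpand F b (f / f₀) * (laurentExpand F b f₀ / f₀) / (f / f₀) := by
    rw [map_div₀]
    field_simp
  rw [heq]
  exact div_mem (mul_mem (laurentExpand_mem_rationalSeries.mpr hf) hf₀b) hf

/-- The `F`-linear map `p ↦ p φ` from Laurent polynomials to Laurent series. -/
def mulSeries (φ : LaurentSeries F) : F[T;T⁻¹] →ₗ[F] LaurentSeries F :=
  (LinearMap.toSpanSingleton F[T;T⁻¹] (LaurentSeries F) φ).restrictScalars F

theorem mulSeries_apply (φ : LaurentSeries F) (p : F[T;T⁻¹]) :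
    mulSeries φ p = algebraMap F[T;T⁻¹] (LaurentSeries F) p * φ :=
  Algebra.smul_def p φ

theorem mulSeries_injective {φ : LaurentSeries F} (hφ : φ ≠ 0) :
    Function.Injective (mulSeries φ) :=
  smul_left_injective _ hφ

theorem span_range_mulSeries (φ : LaurentSeries F) {s : ℕ} (p : Fin s → F[T;T⁻¹]) :
    Submodule.span F (Set.range fun j => mulSeries φ (p j)) =
      (Submodule.span F (Set.range p)).map (mulSeries φ) := by
  rw [Submodule.map_span, ← Set.range_comp]
  rfl

theorem isCoprimeFamily_iff_span_eq {s : ℕ} {p : Fin s → F[T;T⁻¹]} {φ : LaurentSeries F}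
    {V : Submodule F (LaurentSeries F)} (hφ : φ ≠ 0)
    (hV : Submodule.span F (Set.range fun j => mulSeries φ (p j)) = V) :
    IsCoprimeFamily p ↔
      Submodule.span F[T;T⁻¹] (V : Set (LaurentSeries F)) = F[T;T⁻¹] ∙ φ := by
  rw [← hV, Submodule.span_span_of_tower]
  exact isCoprimeFamily_iff_span_range_smul_eq hφ

theorem IsPrincipalUnit.finite_valuations_comap {φ : LaurentSeries F} (hφ : IsPrincipalUnit φ)
    {V : Submodule F (LaurentSeries F)}
    (hV : (HahnSeries.order '' {f | f ∈ V ∧ f ≠ 0}).Finite) :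
    (valuations (V.comap (mulSeries φ))).Finite := by
  refine hV.subset ?_
  rintro n ⟨p, hp, hn⟩
  have hp0 : algebraMap F[T;T⁻¹] (LaurentSeries F) p ≠ 0 := by
    refine HahnSeries.ne_zero_of_coeff_ne_zero (g := n) ?_
    rw [coeff_algebraMap]
    exact hn.1
  refine ⟨mulSeries φ p, ⟨hp, ?_⟩, ?_⟩
  · rw [mulSeries_apply]
    exact mul_ne_zero hp0 hφ.ne_zero
  · rw [mulSeries_apply, HahnSeries.order_mul hp0 hφ.ne_zero, hφ.order_eq_zero, add_zero,
      order_algebraMap_eq_of_isLeast hn]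

/-- The conditions on `g` and on the `p_j` under which the products `p_j(x) ∏ 1 / g(x ^ (b ^ k))`
are the normal form of a basis of the space `V` of Laurent series. -/
structure IsNormalForm (b : ℕ+) (V : Submodule F (LaurentSeries F)) (t : NormalFormData F) :
    Prop where
  s_pos : 0 < t.s
  eval_zero : RatFunc.eval (RingHom.id F) 0 t.g = 1
  span_eq : Submodule.span F (Set.range fun j => mulSeries (infProdLaurent b t.g) (t.p j)) = V
  isReducedEchelon : IsReducedEchelon t.p
  isCoprimeFamily : IsCoprimeFamily t.p

theorem exists_infProdLaurent_span_eq {b : ℕ+} (hb : 2 ≤ (b : ℕ))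
    {V : Submodule F (LaurentSeries F)} [FiniteDimensional F V] (hV0 : V ≠ ⊥)
    {f₀ : LaurentSeries F} (hf₀ : f₀ ≠ 0) (hf₀b : laurentExpand F b f₀ / f₀ ∈ rationalSeries F)
    (hV : ∀ v ∈ V, v / f₀ ∈ rationalSeries F) :
    ∃ g : RatFunc F, RatFunc.eval (RingHom.id F) 0 g = 1 ∧
      Submodule.span F[T;T⁻¹] (V : Set (LaurentSeries F)) = F[T;T⁻¹] ∙ infProdLaurent b g := by
  have hspan0 : Submodule.span F[T;T⁻¹] (V : Set (LaurentSeries F)) ≠ ⊥ := by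
    obtain ⟨v, hv, hv0⟩ := V.exists_mem_ne_zero_of_ne_bot hV0
    exact (Submodule.ne_bot_iff _).mpr ⟨v, Submodule.subset_span hv, hv0⟩
  obtain ⟨φ, hφ, hspan⟩ := exists_isPrincipalUnit_eq_span_singleton
    (isPrincipal_span_of_div_mem_rationalSeries V hf₀ hV) hspan0
  have hφr : φ / f₀ ∈ rationalSeries F :=
    div_mem_rationalSeries_of_mem_span hV (hspan ▸ Submodule.mem_span_singleton_self φ)
  obtain ⟨g, hg, rfl⟩ :=
    hφ.exists_eq_infProdLaurent hb (laurentExpand_div_mem_rationalSeries hf₀ hf₀b hφr)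
  exact ⟨g, hg, hspan⟩

theorem exists_isNormalForm {b : ℕ+} (hb : 2 ≤ (b : ℕ)) (lam : Fˣ)
    {V : Submodule F (LaurentSeries F)} (hV0 : V ≠ ⊥)
    (hfin : (HahnSeries.order '' {f | f ∈ V ∧ f ≠ 0}).Finite)
    {f₀ : LaurentSeries F} (hf₀ : f₀ ≠ 0) (hf₀b : laurentExpand F b f₀ / f₀ ∈ rationalSeries F)
    (hV : ∀ v ∈ V, v / f₀ ∈ rationalSeries F) :
    ∃ t : NormalFormData F, t.lam = lam ∧ IsNormalForm b V t := by
  have := finiteDimensional_of_finite_order_image hfin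
  obtain ⟨g, hg, hspan⟩ := exists_infProdLaurent_span_eq hb hV0 hf₀ hf₀b hV
  have hφ := isPrincipalUnit_infProdLaurent b hg
  obtain ⟨s, p, hp, hech⟩ := exists_isReducedEchelon (hφ.finite_valuations_comap hfin)
  have hrange : V ≤ LinearMap.range (mulSeries (infProdLaurent b g)) := fun v hv =>
    Submodule.mem_span_singleton.mp (hspan ▸ Submodule.subset_span hv)
  have hpV : Submodule.span F (Set.range fun j => mulSeries (infProdLaurent b g) (p j)) = V := by
    rw [span_range_mulSeries, hp, Submodule.map_comap_eq_self hrange]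
  refine ⟨⟨lam, g, s, p⟩, rfl, Nat.pos_of_ne_zero ?_, hg, hpV, hech,
    (isCoprimeFamily_iff_span_eq hφ.ne_zero hpV).mpr hspan⟩
  rintro rfl
  rw [Set.range_eq_empty, Submodule.span_empty] at hpV
  exact hV0 hpV.symm

theorem IsNormalForm.eq {b : ℕ+} (hb : 2 ≤ (b : ℕ)) {V : Submodule F (LaurentSeries F)}
    {t t' : NormalFormData F} (h : IsNormalForm b V t) (h' : IsNormalForm b V t')
    (hlam : t.lam = t'.lam) : t = t' := by
  have hφ := isPrincipalUnit_infProdLaurent b h.eval_zero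
  have hφ' := isPrincipalUnit_infProdLaurent b h'.eval_zero
  have hg : t.g = t'.g := infProdLaurent_injOn hb h.eval_zero h'.eval_zero <|
    hφ.eq_of_span_singleton_eq hφ' <|
      ((isCoprimeFamily_iff_span_eq hφ.ne_zero h.span_eq).mp h.isCoprimeFamily).symm.trans
        ((isCoprimeFamily_iff_span_eq hφ'.ne_zero h'.span_eq).mp h'.isCoprimeFamily)
  have hspan : Submodule.span F (Set.range t.p) = Submodule.span F (Set.range t'.p) := by
    apply Submodule.map_injective_of_injective (mulSeries_injective hφ.ne_zero)
    rw [← span_range_mulSeries, h.span_eq, hg, ← span_range_mulSeries, h'.span_eq]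
  obtain ⟨hs, hp⟩ := h.isReducedEchelon.eq_of_span_eq h'.isReducedEchelon hspan
  obtain ⟨lam, g, s, p⟩ := t
  obtain ⟨lam', g', s', p'⟩ := t'
  dsimp only at hs hp hg hlam
  subst hs hg hlam
  rw [hp, Fin.cast_refl, Function.comp_id]

end NormalForm

section SingleTerm

variable {F : Type*} [Field F]

theorem order_hahnExpand (b : ℕ+) (w : HahnSeries ℚ F) :
    (hahnExpand F b w).order = (b : ℕ) * w.order := by
  by_cases hw : w = 0
  · rw [hw, map_zero, HahnSeries.order_zero, mul_zero]
  have hw' : hahnExpand F b w ≠ 0 := (_root_.map_ne_zero _).mpr hw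
  apply WithTop.coe_injective
  rw [HahnSeries.order_eq_orderTop_of_ne_zero hw']
  refine HahnSeries.orderTop_embDomain.trans ?_
  rw [← HahnSeries.order_eq_orderTop_of_ne_zero hw]
  rfl

theorem eq_of_C_mul_hahnExpand_eq {b : ℕ+} (hb : 2 ≤ (b : ℕ)) {w : HahnSeries ℚ F} (hw : w ≠ 0)
    {lam mu : Fˣ} (h : HahnSeries.C (lam : F) * hahnExpand F b w = HahnSeries.C (mu : F) * w) :
    lam = mu := by
  have hC (c : Fˣ) : (HahnSeries.C (c : F) : HahnSeries ℚ F) ≠ 0 :=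
    (_root_.map_ne_zero _).mpr c.ne_zero
  have horder : w.order = 0 := by
    have h' := congrArg HahnSeries.order h
    rw [HahnSeries.order_mul (hC _) ((_root_.map_ne_zero _).mpr hw), HahnSeries.order_mul (hC _) hw,
      HahnSeries.order_C, HahnSeries.order_C, order_hahnExpand, zero_add, zero_add] at h'
    exact (mul_left_eq_self₀.mp h').resolve_left (by exact_mod_cast (by omega : (b : ℕ) ≠ 1))
  have hcoeff : w.coeff 0 ≠ 0 := fun h0 => hw (HahnSeries.coeff_order_eq_zero.mp (horder ▸ h0))
  have h0 := congrArg (fun f : HahnSeries ℚ F => f.coeff 0) h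
  simp only [HahnSeries.C_mul_eq_smul, HahnSeries.coeff_smul, coeff_hahnExpand, zero_div,
    smul_eq_mul] at h0
  exact Units.ext (mul_right_cancel₀ hcoeff h0)

theorem eq_of_smul_mahlerPuiseux_eq {b : ℕ+} (hb : 2 ≤ (b : ℕ)) {lam mu : Fˣ}
    {u p p' : Puiseux F} (hp : p ≠ 0) (hp' : p' ≠ 0)
    (h : (lam : F) • mahlerPuiseux b p = u * p) (h' : (mu : F) • mahlerPuiseux b p' = u * p') :
    lam = mu := by
  have hMp' : mahlerPuiseux b p' ≠ 0 := (_root_.map_ne_zero _).mpr hp'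
  rw [Algebra.smul_def] at h h'
  have hquot : algebraMap F (Puiseux F) lam * mahlerPuiseux b (p / p') =
      algebraMap F (Puiseux F) mu * (p / p') := by
    rw [map_div₀, mul_div_assoc', mul_div_assoc', div_eq_div_iff hMp' hp']
    linear_combination p' * h - p * h'
  refine eq_of_C_mul_hahnExpand_eq hb (w := (p / p' : Puiseux F)) ?_ ?_
  · exact fun h0 => div_ne_zero hp hp' (Subtype.ext h0)
  · simpa only [Subfield.coe_mul, coe_algebraMap_puiseux, coe_mahlerPuiseux] using
      congrArg Subtype.val hquot

theorem IsRamRatHypergeometric.exists_eq_expo {b : ℕ+} (hb : 2 ≤ (b : ℕ)) {y : GenSeries F}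
    (hy0 : y ≠ 0) (hy : IsRamRatHypergeometric b y) :
    ∃ (lam : Fˣ) (p : Puiseux F), p ≠ 0 ∧ y = expo lam p := by
  obtain ⟨u, -, hu⟩ := hy
  have hcoeff (mu : Fˣ) : (mu : F) • mahlerPuiseux b (y.coeff mu) = u * y.coeff mu := by
    rw [← coeff_mahler, hu]
    rfl
  obtain ⟨lam, hlam⟩ : ∃ lam, y.coeff lam ≠ 0 := by
    by_contra! h
    exact hy0 (MonoidAlgebra.ext (Finsupp.ext h))
  refine ⟨lam, y.coeff lam, hlam, MonoidAlgebra.ext (Finsupp.ext fun mu => ?_)⟩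
  by_cases hmu : lam = mu
  · simp [expo, hmu]
  · have hzero : y.coeff mu = 0 := by_contra fun h =>
      hmu (eq_of_smul_mahlerPuiseux_eq hb hlam h (hcoeff lam) (hcoeff mu))
    simp [expo, hmu, hzero]

end SingleTerm

section BaseChange

theorem hahnRamify_map {F E : Type*} [Field F] [Field E] (φ : F →+* E) (q : ℕ+)
    (f : LaurentSeries F) :
    hahnRamify E q (f.map φ) = (hahnRamify F q f).map φ := by
  ext a
  rw [HahnSeries.map_coeff]
  by_cases h : ∃ n : ℤ, (n : ℚ) / (q : ℕ) = a
  · obtain ⟨n, rfl⟩ := h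
    rw [coeff_hahnRamify, coeff_hahnRamify, HahnSeries.map_coeff]
  · rw [not_imp_comm.mp exists_eq_div_of_coeff_hahnRamify_ne_zero h,
      not_imp_comm.mp exists_eq_div_of_coeff_hahnRamify_ne_zero h, map_zero]

theorem exists_puiseux_coeff_eq_comp {F E : Type*} [Field F] [Field E] (φ : F →+* E)
    (p : Puiseux F) :
    ∃ p' : Puiseux E, (p' : HahnSeries ℚ E).coeff = φ ∘ (p : HahnSeries ℚ F).coeff := by
  obtain ⟨_, q, f, rfl⟩ := p
  exact ⟨ramify q (f.map φ), congrArg HahnSeries.coeff (hahnRamify_map φ q f)⟩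

variable {K F E : Type*} [Field K] [Field F] [Field E] [Algebra K F] [Algebra K E] [Algebra F E]
  [IsScalarTower K F E] {b : ℕ+} {r : ℕ} {ℓ : Fin (r + 1) → K[X]}

theorem coeffOp_algebraMap_comp (mu : F) (c : ℚ → F) :
    coeffOp b ℓ (algebraMap F E mu) (algebraMap F E ∘ c) = algebraMap F E ∘ coeffOp b ℓ mu c := by
  ext a
  simp only [coeffOp_apply, Function.comp_apply, map_sum, map_mul, map_pow,
    ← IsScalarTower.algebraMap_apply]

theorem isAdmissibleEdge_algebraMap_iff {mu : F} {i j : Fin (r + 1)} :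
    IsAdmissibleEdge b ℓ (algebraMap F E mu) i j ↔ IsAdmissibleEdge b ℓ mu i j := by
  rw [IsAdmissibleEdge, IsAdmissibleEdge, aeval_algebraMap_eq_zero_iff]

theorem ramBound_algebraMap (mu : F) : ramBound b ℓ (algebraMap F E mu) = ramBound b ℓ mu := by
  classical
  refine Subtype.ext (congrArg (Finset.lcm · _) (Finset.filter_congr fun e _ => ?_))
  rw [isAdmissibleEdge_algebraMap_iff]

variable (E) in
theorem mem_solRootSet (hb : 2 ≤ (b : ℕ)) (hℓ : ℓ ≠ 0) {mu : Fˣ} {p : Puiseux F} (hp : p ≠ 0)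
    (h : applyOp b ℓ (expo mu p) = 0) : algebraMap F E mu ∈ solRootSet b ℓ E := by
  rw [applyOp_expo_eq_zero_iff] at h
  have hp' : (p : HahnSeries ℚ F) ≠ 0 := fun h0 => hp (Subtype.ext h0)
  constructor
  · obtain ⟨i, j, hij, -⟩ := exists_isAdmissibleEdge_of_coeffOp_eq_zero hb hℓ mu.ne_zero
      (isLeast_support_coeff_order hp') h
    exact ⟨i, j, isAdmissibleEdge_algebraMap_iff.mpr hij⟩
  · obtain ⟨pE, hpE⟩ := exists_puiseux_coeff_eq_comp (algebraMap F E) p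
    refine ⟨Units.map (algebraMap F E).toMonoidHom mu, pE, rfl, ?_, ?_⟩
    · rintro rfl
      refine hp' (HahnSeries.ext (funext fun a => (algebraMap F E).injective ?_))
      simpa using (congrFun hpE a).symm
    · rw [applyOp_expo_eq_zero_iff, hpE]
      refine (coeffOp_algebraMap_comp (mu : F) _).trans ?_
      rw [h]
      exact funext fun _ => map_zero _

theorem exists_eq_ramify_ramBound (hb : 2 ≤ (b : ℕ)) (hℓ₀ : ℓ 0 ≠ 0)
    {mu : Fˣ} {p : Puiseux F} (h : applyOp b ℓ (expo mu p) = 0) :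
    ∃ f, ramify (ramBound b ℓ (mu : F)) f = p := by
  obtain ⟨N, hN⟩ := exists_den_le p
  exact (mem_range_ramify_iff _ p).mpr fun a ha => den_dvd_ramBound hb hℓ₀ mu.ne_zero
    (isWF_support_coeff _) hN ((applyOp_expo_eq_zero_iff b ℓ mu p).mp h) ha

end BaseChange

section Solutions

variable {F : Type*} [Field F]

theorem smul_mem_rationalSeries (c : F) {f : LaurentSeries F} (hf : f ∈ rationalSeries F) :
    c • f ∈ rationalSeries F := by
  rw [← HahnSeries.C_mul_eq_smul]
  exact mul_mem (single_mem_rationalSeries 0 c) hf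

theorem smul_div_laurentSeries (c : F) (f g : LaurentSeries F) : c • f / g = c • (f / g) := by
  rw [← HahnSeries.C_mul_eq_smul, ← HahnSeries.C_mul_eq_smul, mul_div_assoc]

/-- The `F`-linear map `f(x) ↦ e(λ) f(x ^ (1 / q))`. -/
def expoRamify (lam : Fˣ) (q : ℕ+) : LaurentSeries F →ₗ[F] GenSeries F where
  toFun f := expo lam (ramify q f)
  map_add' f f' := by rw [map_add]; exact MonoidAlgebra.single_add ..
  map_smul' c f := by rw [ramify_smul, smul_expo, RingHom.id_apply]

theorem expoRamify_apply (lam : Fˣ) (q : ℕ+) (f : LaurentSeries F) :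
    expoRamify lam q f = expo lam (ramify q f) := rfl

theorem ramify_ne_zero (q : ℕ+) {f : LaurentSeries F} (hf : f ≠ 0) : ramify q f ≠ 0 :=
  (_root_.map_ne_zero _).mpr hf

theorem expoRamify_injective (lam : Fˣ) (q : ℕ+) : Function.Injective (expoRamify lam q) :=
  (injective_iff_map_eq_zero _).mpr fun _ hf => by_contra fun hf0 =>
    ramify_ne_zero q hf0 (MonoidAlgebra.single_eq_zero.mp hf)

theorem expoRamify_eq_smul_iff {lam : Fˣ} {q : ℕ+} {f f₀ : LaurentSeries F} (hf₀ : f₀ ≠ 0)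
    (u : Puiseux F) :
    expoRamify lam q f = u • expoRamify lam q f₀ ↔ u = ramify q (f / f₀) := by
  have hf₀' := ramify_ne_zero q hf₀
  rw [expoRamify_apply, expoRamify_apply, smul_expo, smul_eq_mul, map_div₀, eq_div_iff hf₀']
  exact MonoidAlgebra.single_right_inj.trans eq_comm

theorem mahler_expoRamify (b : ℕ+) (lam : Fˣ) (q : ℕ+) (f : LaurentSeries F) :
    mahler b (expoRamify lam q f) = expoRamify lam q ((lam : F) • laurentExpand F b f) := by
  rw [expoRamify_apply, mahler_expo, mahlerPuiseux_ramify, ← ramify_smul, expoRamify_apply]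

theorem isRamRatHypergeometric_expoRamify_iff {b : ℕ+} {lam : Fˣ} {q : ℕ+} {f : LaurentSeries F}
    (hf : f ≠ 0) :
    IsRamRatHypergeometric b (expoRamify lam q f) ↔ laurentExpand F b f / f ∈ rationalSeries F := by
  simp only [IsRamRatHypergeometric, mahler_expoRamify, expoRamify_eq_smul_iff hf,
    exists_eq_right, ramify_mem_ramRat, smul_div_laurentSeries]
  refine ⟨fun h => ?_, smul_mem_rationalSeries _⟩
  simpa using smul_mem_rationalSeries (lam : F)⁻¹ h

theorem ramRatSimilar_expoRamify_iff {lam : Fˣ} {q : ℕ+} {f f₀ : LaurentSeries F} (hf₀ : f₀ ≠ 0) :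
    RamRatSimilar (expoRamify lam q f) (expoRamify lam q f₀) ↔
      f ≠ 0 ∧ f / f₀ ∈ rationalSeries F := by
  simp only [RamRatSimilar, expoRamify_eq_smul_iff hf₀, ← and_assoc, exists_eq_right,
    ramify_mem_ramRat, _root_.map_ne_zero, div_ne_zero_iff]
  tauto

theorem order_ramify (q : ℕ+) (f : LaurentSeries F) :
    (ramify q f : HahnSeries ℚ F).order = f.order / (q : ℕ) := by
  by_cases hf : f = 0
  · simp [hf]
  have hf' : hahnRamify F q f ≠ 0 := (_root_.map_ne_zero _).mpr hf
  apply WithTop.coe_injective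
  rw [coe_ramify, HahnSeries.order_eq_orderTop_of_ne_zero hf']
  refine HahnSeries.orderTop_embDomain.trans ?_
  rw [← HahnSeries.order_eq_orderTop_of_ne_zero hf]
  rfl

variable {K : Type*} [Field K] [Algebra K F] {b : ℕ+} {r : ℕ} {ℓ : Fin (r + 1) → K[X]}

variable (b ℓ) in
/-- The space of Laurent series `f` in `F(x) f₀` for which `e(λ) f(x ^ (1 / q))` is a solution. It
describes the similarity class of `e(λ) f₀(x ^ (1 / q))` when `q` is the ramification bound. -/
def rationalSolutions (lam : Fˣ) (q : ℕ+) (f₀ : LaurentSeries F) :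
    Submodule F (LaurentSeries F) where
  carrier := {f | applyOp b ℓ (expoRamify lam q f) = 0 ∧ f / f₀ ∈ rationalSeries F}
  zero_mem' := by
    constructor
    · rw [expoRamify_apply, map_zero, applyOp_expo_eq_zero_iff]
      exact map_zero (coeffOp b ℓ (lam : F))
    · rw [zero_div]
      exact zero_mem _
  add_mem' {f f'} hf hf' := by
    simp only [Set.mem_ofPred_eq, expoRamify_apply, applyOp_expo_eq_zero_iff] at hf hf' ⊢
    rw [map_add, Subfield.coe_add, HahnSeries.coeff_add', map_add, hf.1, hf'.1, add_zero, add_div]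
    exact ⟨rfl, add_mem hf.2 hf'.2⟩
  smul_mem' c f hf := by
    simp only [Set.mem_ofPred_eq, expoRamify_apply, applyOp_expo_eq_zero_iff] at hf ⊢
    rw [ramify_smul, coe_smul_puiseux, HahnSeries.coeff_smul', map_smul, hf.1, smul_zero,
      smul_div_laurentSeries]
    exact ⟨rfl, smul_mem_rationalSeries c hf.2⟩

theorem finite_order_image_rationalSolutions (hb : 2 ≤ (b : ℕ)) (hℓ : ℓ ≠ 0) (lam : Fˣ)
    (q : ℕ+) (f₀ : LaurentSeries F) :
    (HahnSeries.order '' {f | f ∈ rationalSolutions b ℓ lam q f₀ ∧ f ≠ 0}).Finite := by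
  have hq : ((q : ℕ) : ℚ) ≠ 0 := by exact_mod_cast q.ne_zero
  have hinj : Function.Injective fun n : ℤ => -((n : ℚ) / (q : ℕ)) := fun m n h => by
    simpa [div_left_inj' hq] using h
  refine ((Set.finite_range fun e : Fin (r + 1) × Fin (r + 1) =>
    edgeSlope b ℓ e.1 e.2).preimage hinj.injOn).subset ?_
  rintro _ ⟨f, ⟨⟨hf, -⟩, hf0⟩, rfl⟩
  have hf' : (ramify q f : HahnSeries ℚ F) ≠ 0 := fun h => ramify_ne_zero q hf0 (Subtype.ext h)
  obtain ⟨i, j, -, hij⟩ := exists_isAdmissibleEdge_of_coeffOp_eq_zero hb hℓ lam.ne_zero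
    (isLeast_support_coeff_order hf') ((applyOp_expo_eq_zero_iff b ℓ lam _).mp hf)
  exact ⟨(i, j), hij.trans (by rw [order_ramify])⟩

theorem insert_zero_class_eq_map_rationalSolutions (hb : 2 ≤ (b : ℕ)) (hℓ₀ : ℓ 0 ≠ 0) {lam : Fˣ}
    {f₀ : LaurentSeries F} (hf₀ : f₀ ≠ 0)
    (hf₀b : laurentExpand F b f₀ / f₀ ∈ rationalSeries F) :
    insert 0 {y | applyOp b ℓ y = 0 ∧ IsRamRatHypergeometric b y ∧
        RamRatSimilar y (expoRamify lam (ramBound b ℓ (lam : F)) f₀)} =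
      ((rationalSolutions b ℓ lam (ramBound b ℓ (lam : F)) f₀).map
        (expoRamify lam (ramBound b ℓ (lam : F))) : Set (GenSeries F)) := by
  ext y
  constructor
  · rintro (rfl | ⟨hy, -, hsim⟩)
    · exact Submodule.zero_mem _
    · obtain ⟨f, rfl⟩ : ∃ f, expoRamify lam (ramBound b ℓ (lam : F)) f = y := by
        obtain ⟨u, -, -, rfl⟩ := hsim
        rw [expoRamify_apply, smul_expo] at hy ⊢
        obtain ⟨f, hf⟩ := exists_eq_ramify_ramBound hb hℓ₀ hy
        exact ⟨f, by rw [expoRamify_apply, hf]⟩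
      exact ⟨f, ⟨hy, ((ramRatSimilar_expoRamify_iff hf₀).mp hsim).2⟩, rfl⟩
  · rintro ⟨f, ⟨hf, hfr⟩, rfl⟩
    rcases eq_or_ne f 0 with rfl | hf0
    · exact Or.inl (map_zero _)
    · exact Or.inr ⟨hf, (isRamRatHypergeometric_expoRamify_iff hf0).mpr
        (laurentExpand_div_mem_rationalSeries hf₀ hf₀b hfr),
        (ramRatSimilar_expoRamify_iff hf₀).mpr ⟨hf0, hfr⟩⟩

theorem NormalFormData.basisElt_eq (t : NormalFormData F) (b q : ℕ+) :
    t.basisElt b q =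
      expoRamify t.lam q ∘ fun j => mulSeries (infProdLaurent b t.g) (t.p j) := by
  ext1 j
  rw [Function.comp_apply, mulSeries_apply, ← laurentPolyToSeries_eq_algebraMap]
  rfl

theorem NormalFormData.span_range_basisElt (t : NormalFormData F) (b q : ℕ+) :
    Submodule.span F (Set.range (t.basisElt b q)) =
      (Submodule.span F (Set.range fun j => mulSeries (infProdLaurent b t.g) (t.p j))).map
        (expoRamify t.lam q) := by
  rw [Submodule.map_span, ← Set.range_comp, t.basisElt_eq]

theorem IsNormalForm.linearIndependent_basisElt {V : Submodule F (LaurentSeries F)}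
    {t : NormalFormData F} (ht : IsNormalForm b V t) (q : ℕ+) :
    LinearIndependent F (t.basisElt b q) := by
  rw [t.basisElt_eq]
  exact (ht.isReducedEchelon.linearIndependent.map' (mulSeries (infProdLaurent b t.g))
    (LinearMap.ker_eq_bot.mpr
      (mulSeries_injective (isPrincipalUnit_infProdLaurent b ht.eval_zero).ne_zero))).map' _
    (LinearMap.ker_eq_bot.mpr (expoRamify_injective t.lam q))

theorem NormalFormData.lam_eq_of_basisElt_mem {t : NormalFormData F} {b q q' : ℕ+} {j : Fin t.s}
    {lam : Fˣ} {V : Submodule F (LaurentSeries F)} (h0 : t.basisElt b q j ≠ 0)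
    (h : t.basisElt b q j ∈ V.map (expoRamify lam q')) : t.lam = lam := by
  obtain ⟨f, -, hf⟩ := h
  refine ((expo_inj fun hp => h0 ?_).mp hf.symm).1
  rw [basisElt, hp]
  exact MonoidAlgebra.single_zero _

theorem IsNontrivialSimilarityClass.exists_insert_zero_eq_map (hb : 2 ≤ (b : ℕ)) (hℓ₀ : ℓ 0 ≠ 0)
    {C : Set (GenSeries F)} (hC : IsNontrivialSimilarityClass b ℓ C) :
    ∃ (lam : Fˣ) (f₀ : LaurentSeries F), f₀ ≠ 0 ∧
      laurentExpand F b f₀ / f₀ ∈ rationalSeries F ∧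
      f₀ ∈ rationalSolutions b ℓ lam (ramBound b ℓ (lam : F)) f₀ ∧
      insert 0 C = ((rationalSolutions b ℓ lam (ramBound b ℓ (lam : F)) f₀).map
        (expoRamify lam (ramBound b ℓ (lam : F))) : Set (GenSeries F)) := by
  obtain ⟨y₀, hy₀, hsol, hhyp, rfl⟩ := hC
  obtain ⟨lam, p₀, hp₀, rfl⟩ := hhyp.exists_eq_expo hb hy₀
  obtain ⟨f₀, rfl⟩ := exists_eq_ramify_ramBound hb hℓ₀ hsol
  have hf₀ : f₀ ≠ 0 := fun h => hp₀ (by rw [h, map_zero])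
  have hf₀b := (isRamRatHypergeometric_expoRamify_iff hf₀).mp hhyp
  refine ⟨lam, f₀, hf₀, hf₀b, ⟨hsol, ?_⟩,
    insert_zero_class_eq_map_rationalSolutions hb hℓ₀ hf₀ hf₀b⟩
  rw [div_self hf₀]
  exact one_mem _

end Solutions

end Mahler

end

theorem mainTheorem9_general {K F E : Type*} [Field K] [Field F] [Field E] [Algebra K F]
    [Algebra K E] [Algebra F E] [IsScalarTower K F E] (b : ℕ+) (hb : 2 ≤ (b : ℕ)) (r : ℕ)
    (ℓ : Fin (r + 1) → K[X]) (hℓ₀ : ℓ 0 ≠ 0) (C : Set (Mahler.GenSeries F))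
    (hC : Mahler.IsNontrivialSimilarityClass b ℓ C) :
    ∃! t : Mahler.NormalFormData F,
      algebraMap F E t.lam ∈ Mahler.solRootSet b ℓ E ∧
      0 < t.s ∧
      RatFunc.eval (RingHom.id F) 0 t.g = 1 ∧
      (LinearIndependent F (t.basisElt b (Mahler.ramBound b ℓ (algebraMap F E t.lam))) ∧
        (Submodule.span F
            (Set.range (t.basisElt b (Mahler.ramBound b ℓ (algebraMap F E t.lam)))) :
          Set (Mahler.GenSeries F)) = insert 0 C) ∧
      Mahler.IsReducedEchelon t.p ∧
      Mahler.IsCoprimeFamily t.p := by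
  have hℓ : ℓ ≠ 0 := Function.ne_iff.mpr ⟨0, hℓ₀⟩
  simp only [Mahler.ramBound_algebraMap]
  obtain ⟨lam, f₀, hf₀, hf₀b, hf₀V, hV⟩ := hC.exists_insert_zero_eq_map hb hℓ₀
  obtain ⟨t, rfl, ht⟩ := Mahler.exists_isNormalForm hb lam
    ((Submodule.ne_bot_iff _).mpr ⟨f₀, hf₀V, hf₀⟩)
    (Mahler.finite_order_image_rationalSolutions hb hℓ lam _ f₀) hf₀ hf₀b fun _ hv => hv.2
  rw [hV]
  refine ⟨t, ⟨Mahler.mem_solRootSet E hb hℓ (Mahler.ramify_ne_zero _ hf₀) hf₀V.1, ht.s_pos,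
    ht.eval_zero, ⟨ht.linearIndependent_basisElt _, ?_⟩, ht.isReducedEchelon,
    ht.isCoprimeFamily⟩, ?_⟩
  · rw [t.span_range_basisElt, ht.span_eq]
  · rintro t' ⟨-, hs', hg', ⟨hli', hspan'⟩, hech', hcop'⟩
    have hlam : t'.lam = t.lam := Mahler.NormalFormData.lam_eq_of_basisElt_mem
      (hli'.ne_zero ⟨0, hs'⟩) (hspan'.subset (Submodule.subset_span (Set.mem_range_self _)))
    rw [t'.span_range_basisElt, hlam, SetLike.coe_set_eq] at hspan'
    have hspan := Submodule.map_injective_of_injective (Mahler.expoRamify_injective t.lam _) hspan'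
    exact Mahler.IsNormalForm.eq hb ⟨hs', hg', hspan, hech', hcop'⟩ ht hlam

theorem mainTheorem9 {K Kbar : Type*} [Field K] [CharZero K] [Field Kbar] [Algebra K Kbar]
    [IsAlgClosure K Kbar] (L : IntermediateField K Kbar)
    (b : ℕ+) (hb : 2 ≤ (b : ℕ)) (r : ℕ) (ℓ : Fin (r + 1) → K[X])
    (hℓ₀ : ℓ 0 ≠ 0) (hℓr : ℓ (Fin.last r) ≠ 0)
    (C : Set (Mahler.GenSeries L)) (hC : Mahler.IsNontrivialSimilarityClass b ℓ C) :
    ∃! t : Mahler.NormalFormData L,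
      ((t.lam : L) : Kbar) ∈ Mahler.solRootSet b ℓ Kbar ∧
      0 < t.s ∧
      RatFunc.eval (RingHom.id L) 0 t.g = 1 ∧
      (LinearIndependent L
          (t.basisElt b (Mahler.ramBound b ℓ ((t.lam : L) : Kbar))) ∧
        (Submodule.span L
            (Set.range (t.basisElt b (Mahler.ramBound b ℓ ((t.lam : L) : Kbar)))) :
          Set (Mahler.GenSeries L)) = insert 0 C) ∧
      Mahler.IsReducedEchelon t.p ∧
      Mahler.IsCoprimeFamily t.p := by
  exact mainTheorem9_general b hb r ℓ hℓ₀ C hC
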